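/- Let $\varphi:(0,\infty)\to(0,\infty)$ satisfy the following conditions: (i) $\varphi\in C^1((0,\infty))$; (ii) $(s\varphi(s))'>0$ for every $s>0$; (iii) the range of $s\mapsto s\varphi(s)$ on $(0,\infty)$ is $(0,\infty)$; (iv) there are $C_1,C_2>0$, $r>-1$ and $s_0>0$ with $C_1s^r\le (s\varphi(s))'\le C_2s^r$ for $s\in(0,s_0)$; if $r=0$, moreover, $\lim_{s\to0^+}\varphi(s)$ exists, is finite and positive, and $\lim_{s\to0^+}s\varphi'(s)=0$; (v) there is $s_1>s_0$ such that either $\varphi'(s)\ge0$ for all $s\ge s_1$, or $\varphi'(s)\le0$ for all $s\ge s_1$; (vi) $s\mapsto|s\varphi'(s)/\varphi(s)|$ is non-decreasing on $(0,\infty)$. Define $\Lambda$ on $(0,\infty)$ by $$\Lambda\big(s\sqrt{\varphi(s)}\big)=-\frac{s\varphi'(s)}{s\varphi'(s)+2\varphi(s)}\quad(s>0),\qquad \Lambda_\infty=\lim_{t\to\infty}\Lambda(t),$$ and assume $\Lambda_\infty^2<1$. Let $(a,b)\subset\mathbb R$ be a bounded or unbounded open interval, let $\mathscr A(x)$, $x\in(a,b)$,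 be an $m\times m$ matrix with complex entries in $L^1_{\mathrm{loc}}((a,b))$, and consider the operator $Au=(\mathscr A u')'$. Write $\langle\xi,\eta\rangle=\sum_i\xi_i\overline{\eta_i}$ on $\mathbb C^m$, and let $C_0^1$ denote the space of $C^1$ functions with compact support. The operator $A$ is called $L^\Phi$-dissipative if $$\operatorname{Re}\int_a^b\langle\mathscr A u',(\varphi(|u|)u)'\rangle\,dx\ge0$$ for all $u\in[C^1_0((a,b))]^m$ with $\varphi(|u|)u\in[C^1_0((a,b))]^m$, and strictly $L^\Phi$-dissipative if there is $\kappa>0$ such that $$\operatorname{Re}\int_a^b\langle\mathscr A u',(\varphi(|u|)u)'\rangle\,dx\ge\kappa\int_a^b\big|(\sqrt{\varphi(|u|)}\,u)'\big|^2dx$$ for all such $u$ (products with $u$ are taken to be $0$ where $u=0$). Put $$P(x,\lambda,\omega)=\operatorname{Re}\langle\mathscr A(x)\lambda,\lambda\rangle-\Lambda_\infty^2\operatorname{Re}\langle\mathscr A(x)\omega,\omega\rangle(\operatorname{Re}\langle\lambda,\omega\rangle)^2+\Lambda_\infty\operatorname{Re}\big(\langle\mathscr A(x)\omega,\lambda\rangle-\langle\mathscr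 A(x)\lambda,\omega\rangle\big)\operatorname{Re}\langle\lambda,\omega\rangle.$$ Then: 1. $A$ is strictly $L^\Phi$-dissipative if and only if there is $\kappa>0$ such that, for almost every $x\in(a,b)$, $P(x,\lambda,\omega)\ge\kappa|\lambda|^2$ for all $\lambda,\omega\in\mathbb C^m$ with $|\omega|=1$. 2. There is $\kappa>0$ such that $A-\kappa I\,\frac{d^2}{dx^2}$ is $L^\Phi$-dissipative if and only if $$\operatorname*{ess\,inf}_{x\in(a,b),\ |\lambda|=|\omega|=1}P(x,\lambda,\omega)>0,$$ where the essential infimum is taken with respect to the product of Lebesgue measure on $(a,b)$ and the surface measures on the two unit spheres of $\mathbb C^m$. -/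

import Mathlib

open MeasureTheory Filter Topology Set

noncomputable section

/-- Complex `m`-vectors with the Euclidean norm. -/
abbrev CVec (m : ℕ) : Type := EuclideanSpace ℂ (Fin m)

/-- `⟨M ξ, η⟩ = ∑ᵢ (M ξ)ᵢ * conj ηᵢ`. Mathlib's inner product is conjugate-linear in its first
argument, hence the order of the arguments. -/
def sesq {m : ℕ} (M : Matrix (Fin m) (Fin m) ℂ) (ξ η : CVec m) : ℂ :=
  inner ℂ η (Matrix.toEuclideanLin M ξ)

/-- The conditions (i)-(vi) on the positive function `φ : (0, ∞) → (0, ∞)`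
(the values of `φ` outside `(0, ∞)` are irrelevant). -/
structure PhiAdmissible (φ : ℝ → ℝ) : Prop where
  pos : ∀ s, 0 < s → 0 < φ s
  contDiffOn : ContDiffOn ℝ 1 φ (Ioi 0)
  deriv_pos : ∀ s, 0 < s → 0 < deriv (fun t => t * φ t) s
  range_eq : (fun s => s * φ s) '' Ioi 0 = Ioi 0
  growth : ∃ C₁ C₂ r s₀ s₁ : ℝ, 0 < C₁ ∧ 0 < C₂ ∧ -1 < r ∧ 0 < s₀ ∧ s₀ < s₁ ∧
    (∀ s ∈ Ioo 0 s₀, C₁ * s ^ r ≤ deriv (fun t => t * φ t) s ∧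
      deriv (fun t => t * φ t) s ≤ C₂ * s ^ r) ∧
    (r = 0 → (∃ φ₀ : ℝ, 0 < φ₀ ∧ Tendsto φ (𝓝[>] 0) (𝓝 φ₀)) ∧
      Tendsto (fun s => s * deriv φ s) (𝓝[>] 0) (𝓝 0)) ∧
    ((∀ s, s₁ ≤ s → 0 ≤ deriv φ s) ∨ (∀ s, s₁ ≤ s → deriv φ s ≤ 0))
  monotone : MonotoneOn (fun s => |s * deriv φ s / φ s|) (Ioi 0)

/-- The function `Λ` on `(0, ∞)`, determined by
`Λ (s √φ(s)) = - s φ'(s) / (s φ'(s) + 2 φ(s))` for `s > 0`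
(see `capLambda_apply`): at `t` it is the right-hand side taken at the unique
`s > 0` with `s √φ(s) = t`. -/
def capLambda (φ : ℝ → ℝ) (t : ℝ) : ℝ :=
  (fun s => -(s * deriv φ s) / (s * deriv φ s + 2 * φ s))
    (Function.invFunOn (fun s => s * √(φ s)) (Ioi 0) t)

theorem PhiAdmissible.deriv_mul {φ : ℝ → ℝ} (hφ : PhiAdmissible φ) {s : ℝ} (hs : 0 < s) :
    0 < φ s + s * deriv φ s := by
  have hd : DifferentiableAt ℝ φ s :=
    (hφ.contDiffOn.differentiableOn one_ne_zero).differentiableAt (Ioi_mem_nhds hs)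
  have h := ((hasDerivAt_id s).mul hd.hasDerivAt).deriv
  have h2 := hφ.deriv_pos s hs
  have h3 : deriv (fun t => t * φ t) s = 1 * φ s + s * deriv φ s := h
  linarith

theorem PhiAdmissible.strictMonoOn_mul {φ : ℝ → ℝ} (hφ : PhiAdmissible φ) :
    StrictMonoOn (fun s => s * φ s) (Ioi 0) := by
  apply strictMonoOn_of_deriv_pos (convex_Ioi 0)
  · exact continuousOn_id.mul hφ.contDiffOn.continuousOn
  · intro x hx
    rw [interior_Ioi] at hx
    exact hφ.deriv_pos x hx

theorem PhiAdmissible.strictMonoOn_mul_sqrt {φ : ℝ → ℝ} (hφ : PhiAdmissible φ) :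
    StrictMonoOn (fun s => s * √(φ s)) (Ioi 0) := by
  intro s hs t ht hst
  have hs0 : (0 : ℝ) < s := hs
  have ht0 : (0 : ℝ) < t := ht
  have h := hφ.strictMonoOn_mul hs ht hst
  simp only at h ⊢
  have h1 := Real.sq_sqrt (hφ.pos s hs0).le
  have h2 := Real.sq_sqrt (hφ.pos t ht0).le
  have h3 : 0 < s * φ s := mul_pos hs0 (hφ.pos s hs0)
  apply lt_of_pow_lt_pow_left₀ 2 (by positivity)
  rw [mul_pow, mul_pow, h1, h2]
  nlinarith

/-- `s √φ(s)` maps `(0, ∞)` onto `(0, ∞)`. -/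
theorem PhiAdmissible.surjOn_mul_sqrt {φ : ℝ → ℝ} (hφ : PhiAdmissible φ) :
    SurjOn (fun s => s * √(φ s)) (Ioi 0) (Ioi 0) := by
  intro t ht
  have ht0 : (0 : ℝ) < t := ht
  have h1 : t ^ 2 ∈ (fun s => s * φ s) '' Ioi 0 := by
    rw [hφ.range_eq]; exact pow_pos ht0 2
  obtain ⟨c, hc, hct⟩ := h1
  have hc0 : (0 : ℝ) < c := hc
  simp only at hct
  have hsub : uIcc c 1 ⊆ Ioi (0 : ℝ) := fun y hy =>
    lt_of_lt_of_le (lt_min hc0 one_pos) hy.1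
  have hcont : ContinuousOn (fun s => s * (s * φ s)) (uIcc c 1) :=
    (continuousOn_id.mul (continuousOn_id.mul hφ.contDiffOn.continuousOn)).mono hsub
  have hmem : t ^ 2 ∈ uIcc (c * (c * φ c)) (1 * (1 * φ 1)) := by
    rw [hct, mem_uIcc]
    have hm := hφ.strictMonoOn_mul.monotoneOn
    have ht2 : 0 < t ^ 2 := pow_pos ht0 2
    rcases le_total c 1 with h | h
    · left
      have := hm hc (mem_Ioi.2 one_pos : (1 : ℝ) ∈ Ioi 0) h
      simp only [hct] at this
      exact ⟨by nlinarith, by linarith⟩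
    · right
      have := hm (mem_Ioi.2 one_pos : (1 : ℝ) ∈ Ioi 0) hc h
      simp only [hct] at this
      exact ⟨by linarith, by nlinarith⟩
  obtain ⟨s, hs, hst⟩ := intermediate_value_uIcc hcont hmem
  have hs0 : (0 : ℝ) < s := hsub hs
  refine ⟨s, hs0, ?_⟩
  simp only at hst ⊢
  have h2 := Real.sq_sqrt (hφ.pos s hs0).le
  apply (pow_left_inj₀ (by positivity) ht0.le two_ne_zero).1
  rw [mul_pow, h2, ← hst]
  ring

theorem capLambda_apply {φ : ℝ → ℝ} (hφ : PhiAdmissible φ) {s : ℝ} (hs : 0 < s) :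
    capLambda φ (s * √(φ s)) = -(s * deriv φ s) / (s * deriv φ s + 2 * φ s) := by
  have h : Function.invFunOn (fun s => s * √(φ s)) (Ioi 0) (s * √(φ s)) = s :=
    hφ.strictMonoOn_mul_sqrt.injOn.leftInvOn_invFunOn hs
  simp only [capLambda, h]

/-- `Λ_∞ = lim_{t → ∞} Λ(t)` (the limit exists: see `tendsto_capLambda`). -/
def capLambdaInf (φ : ℝ → ℝ) : ℝ := limUnder atTop (capLambda φ)

theorem tendsto_capLambda {φ : ℝ → ℝ} (hφ : PhiAdmissible φ) :
    Tendsto (capLambda φ) atTop (𝓝 (capLambdaInf φ)) := by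
  suffices h : ∃ l, Tendsto (capLambda φ) atTop (𝓝 l) from tendsto_nhds_limUnder h
  obtain ⟨_, _, _, s₀, s₁, _, _, _, h0, h01, _, _, hv⟩ := hφ.growth
  have hs1 : 0 < s₁ := h0.trans h01
  set F : ℝ → ℝ := fun s => -(s * deriv φ s) / (s * deriv φ s + 2 * φ s) with hF
  have hden : ∀ s, 0 < s → 0 < s * deriv φ s + 2 * φ s := fun s hs => by
    have := hφ.deriv_mul hs
    have := hφ.pos s hs
    linarith
  have hpos : ∀ y, 0 < max y s₁ := fun y => lt_of_lt_of_le hs1 (le_max_right _ _)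
  have hF1 : ∀ s, 0 < s → -1 ≤ F s ∧ F s ≤ 1 := fun s hs => by
    have h1 := hφ.deriv_mul hs
    have h2 := hφ.pos s hs
    rw [hF]
    constructor
    · rw [le_div_iff₀ (hden s hs)]; linarith
    · rw [div_le_iff₀ (hden s hs)]; linarith
  have key : ∀ s t, 0 < s → 0 < t → s * deriv φ s / φ s ≤ t * deriv φ t / φ t → F t ≤ F s := by
    intro s t hs ht h
    rw [div_le_div_iff₀ (hφ.pos s hs) (hφ.pos t ht)] at h
    rw [hF]
    simp only
    rw [div_le_div_iff₀ (hden t ht) (hden s hs)]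
    nlinarith
  have hlim : ∃ l, Tendsto (fun s => F (max s s₁)) atTop (𝓝 l) := by
    rcases hv with hv | hv
    · have hanti : Antitone (fun s => F (max s s₁)) := by
        intro y z hyz
        apply key _ _ (hpos y) (hpos z)
        have := hφ.monotone (hpos y) (hpos z) (max_le_max_right s₁ hyz)
        simp only at this
        rwa [abs_of_nonneg, abs_of_nonneg] at this
        · exact div_nonneg (mul_nonneg (hpos z).le (hv _ (le_max_right _ _)))
            (hφ.pos _ (hpos z)).le
        · exact div_nonneg (mul_nonneg (hpos y).le (hv _ (le_max_right _ _)))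
            (hφ.pos _ (hpos y)).le
      exact ⟨_, tendsto_atTop_ciInf hanti ⟨-1, by
        rintro _ ⟨y, rfl⟩; exact (hF1 _ (hpos y)).1⟩⟩
    · have hmono : Monotone (fun s => F (max s s₁)) := by
        intro y z hyz
        apply key _ _ (hpos z) (hpos y)
        have := hφ.monotone (hpos y) (hpos z) (max_le_max_right s₁ hyz)
        simp only at this
        rw [abs_of_nonpos, abs_of_nonpos] at this
        · linarith
        · exact div_nonpos_of_nonpos_of_nonneg
            (mul_nonpos_of_nonneg_of_nonpos (hpos z).le (hv _ (le_max_right _ _)))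
            (hφ.pos _ (hpos z)).le
        · exact div_nonpos_of_nonpos_of_nonneg
            (mul_nonpos_of_nonneg_of_nonpos (hpos y).le (hv _ (le_max_right _ _)))
            (hφ.pos _ (hpos y)).le
      exact ⟨_, tendsto_atTop_ciSup hmono ⟨1, by
        rintro _ ⟨y, rfl⟩; exact (hF1 _ (hpos y)).2⟩⟩
  obtain ⟨l, hl⟩ := hlim
  have hl' : Tendsto F atTop (𝓝 l) := hl.congr' (by
    filter_upwards [eventually_ge_atTop s₁] with y hy
    rw [max_eq_left hy])
  have hg : Tendsto (Function.invFunOn (fun s => s * √(φ s)) (Ioi 0)) atTop atTop := by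
    rw [tendsto_atTop]
    intro N
    have hN : 0 < max N 1 := lt_of_lt_of_le one_pos (le_max_right _ _)
    filter_upwards [eventually_gt_atTop 0,
      eventually_gt_atTop (max N 1 * √(φ (max N 1)))] with t ht0 ht
    have h1 := Function.invFunOn_pos (hφ.surjOn_mul_sqrt ht0)
    have h2 := h1.2
    rw [← h2] at ht
    exact (le_max_left _ _).trans (hφ.strictMonoOn_mul_sqrt.lt_iff_lt hN h1.1 |>.1 ht).le
  exact ⟨l, hl'.comp hg⟩

/-- The open interval `(a, b) ⊆ ℝ`, bounded or unbounded. -/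
def openInterval (a b : EReal) : Set ℝ := {x | a < (x : EReal) ∧ (x : EReal) < b}

/-- `C¹` functions with compact support in the open set `I`. -/
def IsC1c {m : ℕ} (I : Set ℝ) (u : ℝ → CVec m) : Prop :=
  ContDiff ℝ 1 u ∧ HasCompactSupport u ∧ tsupport u ⊆ I

/-- `L^Φ`-dissipativity of the operator `u ↦ (𝒜 u')'` on `I`. -/
def IsPhiDissipative {m : ℕ} (φ : ℝ → ℝ) (I : Set ℝ)
    (𝒜 : ℝ → Matrix (Fin m) (Fin m) ℂ) : Prop :=
  ∀ u : ℝ → CVec m, IsC1c I u → IsC1c I (fun x => φ ‖u x‖ • u x) →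
    0 ≤ (∫ x in I, sesq (𝒜 x) (deriv u x) (deriv (fun y => φ ‖u y‖ • u y) x)).re

/-- Strict `L^Φ`-dissipativity of the operator `u ↦ (𝒜 u')'` on `I`. -/
def IsStrictPhiDissipative {m : ℕ} (φ : ℝ → ℝ) (I : Set ℝ)
    (𝒜 : ℝ → Matrix (Fin m) (Fin m) ℂ) : Prop :=
  ∃ κ : ℝ, 0 < κ ∧ ∀ u : ℝ → CVec m, IsC1c I u → IsC1c I (fun x => φ ‖u x‖ • u x) →
    κ * (∫ x in I, ‖deriv (fun y => √(φ ‖u y‖) • u y) x‖ ^ 2) ≤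
      (∫ x in I, sesq (𝒜 x) (deriv u x) (deriv (fun y => φ ‖u y‖ • u y) x)).re

/-- `P(x, ξ, ω)`, as a function of the matrix `M = 𝒜(x)` and of `L = Λ_∞`. -/
def formP {m : ℕ} (L : ℝ) (M : Matrix (Fin m) (Fin m) ℂ) (ξ ω : CVec m) : ℝ :=
  (sesq M ξ ξ).re - L ^ 2 * (sesq M ω ω).re * (inner ℂ ω ξ).re ^ 2
    + L * (sesq M ω ξ - sesq M ξ ω).re * (inner ℂ ω ξ).re

/-- The essential infimum of `P(x, ξ, ω)` over `x ∈ I`, `|ξ| = |ω| = 1`, with respect to the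
product of Lebesgue measure on `I` and of the surface measures on the two unit spheres. -/
def essInfP {m : ℕ} (L : ℝ) (I : Set ℝ) (𝒜 : ℝ → Matrix (Fin m) (Fin m) ℂ) : EReal :=
  essInf
    (fun z : ℝ × (Metric.sphere (0 : CVec m) 1 × Metric.sphere (0 : CVec m) 1) =>
      ((formP L (𝒜 z.1) z.2.1 z.2.2 : ℝ) : EReal))
    ((volume.restrict I).prod
      ((volume : Measure (CVec m)).toSphere.prod (volume : Measure (CVec m)).toSphere))

end

/-! Where `u ≠ 0`, split `u' = ξ + η` into its real-orthogonal part `ξ` along `u` and the rest `η`.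
Then `(φ(|u|) u)' = φ(|u|) (p ξ + η)` with `p = twistParam φ |u|`, since the map `y ↦ φ(|y|) y`
stretches radially by `(s φ(s))' = p φ` and tangentially by `φ`. So the integrand is `φ(|u|) Re ⟨𝒜
(ξ + η), p ξ + η⟩`, and everything rests on the condition `TwistNonneg p`. As `Λ = (1 - p) / (1 +
p)`, the condition for the limit value `P = twistParamInf φ` is exactly nonnegativity of the form
`formP` (`twistNonneg_iff_formP`).

Sufficiency is pointwise. By condition (vi), every `p(s)` lies between `1` and `P`
(`twistParam_between`), and `TwistNonneg P` passes to all such parameters (`TwistNonneg.between`).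
Zeros of `u` do no harm, because `u' = 0` at almost all of them.

For necessity, take `u` equal to a constant `R ω` on an interval plus an oscillation in a direction
`l`, of amplitude `ε` and frequency `ε⁻²`. After multiplication by `ε²` only the oscillating part of
the energy survives as `ε → 0`, giving `∫ ζ² Re ⟨𝒜 l, phiDir φ (R ω) l⟩ ≥ 0`
(`integral_sq_mul_nonneg`). Lebesgue differentiation makes this pointwise almost everywhere, and `R
→ ∞` replaces `p(R)` by `P` (`ae_twistNonneg`).

For the strict versions, `|(√φ(|u|) u)'|²` and `Re ⟨u', (φ(|u|) u)'⟩` are comparable up to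
constants. Strict dissipativity is therefore dissipativity of `𝒜 - κ` for some `κ > 0`, and
subtracting `κ` lowers `formP` by an amount comparable to `κ |ξ|²`. -/

noncomputable section

/-! ### Linear algebra of the form: `TwistNonneg`, interpolation in the parameter, relation to
`formP`. -/

section Sesq

variable {m : ℕ} (M : Matrix (Fin m) (Fin m) ℂ)

theorem sesq_add_left (ξ ξ' η : CVec m) : sesq M (ξ + ξ') η = sesq M ξ η + sesq M ξ' η := by
  simp [sesq]

theorem sesq_add_right (ξ η η' : CVec m) : sesq M ξ (η + η') = sesq M ξ η + sesq M ξ η' := by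
  simp [sesq]

theorem sesq_smul_left (c : ℝ) (ξ η : CVec m) : sesq M (c • ξ) η = c * sesq M ξ η := by
  rw [sesq, LinearMap.map_smul_of_tower, RCLike.real_smul_eq_coe_smul (K := ℂ), inner_smul_right]
  rfl

theorem sesq_smul_right (c : ℝ) (ξ η : CVec m) : sesq M ξ (c • η) = c * sesq M ξ η := by
  rw [sesq, RCLike.real_smul_eq_coe_smul (K := ℂ), inner_smul_left]
  simp [sesq]

theorem sesq_zero_left (η : CVec m) : sesq M 0 η = 0 := by simp [sesq]

theorem sesq_one (ξ η : CVec m) : sesq 1 ξ η = inner ℂ η ξ := by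
  simp [sesq]

theorem sesq_sub_smul_one (κ : ℝ) (ξ η : CVec m) :
    sesq (M - (κ : ℂ) • 1) ξ η = sesq M ξ η - κ * inner ℂ η ξ := by
  rw [← sesq_one]
  simp only [sesq, map_sub, map_smul, LinearMap.sub_apply, LinearMap.smul_apply, inner_sub_right,
    inner_smul_right]

/-- The sum of the absolute values of the entries. -/
def entrySum : ℝ := ∑ i, ∑ j, ‖M i j‖

theorem entrySum_nonneg : 0 ≤ entrySum M :=
  Finset.sum_nonneg fun _ _ => Finset.sum_nonneg fun _ _ => norm_nonneg _

theorem sesq_eq_sum (ξ η : CVec m) :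
    sesq M ξ η = ∑ i, ∑ j, M i j * ξ j * (starRingEnd ℂ) (η i) := by
  simp only [sesq, PiLp.inner_apply, Matrix.toLpLin_apply, Matrix.mulVec, dotProduct,
    RCLike.inner_apply]
  simp [Finset.sum_mul]

theorem norm_sesq_le (ξ η : CVec m) : ‖sesq M ξ η‖ ≤ entrySum M * (‖ξ‖ * ‖η‖) := by
  rw [sesq_eq_sum, entrySum, Finset.sum_mul]
  refine (norm_sum_le _ _).trans (Finset.sum_le_sum fun i _ => ?_)
  rw [Finset.sum_mul]
  refine (norm_sum_le _ _).trans (Finset.sum_le_sum fun j _ => ?_)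
  rw [norm_mul, norm_mul, RCLike.norm_conj, mul_assoc]
  gcongr
  · exact PiLp.norm_apply_le ξ j
  · exact PiLp.norm_apply_le η i

theorem abs_re_sesq_le (ξ η : CVec m) : |(sesq M ξ η).re| ≤ entrySum M * (‖ξ‖ * ‖η‖) :=
  (Complex.abs_re_le_norm _).trans (norm_sesq_le M ξ η)

theorem continuous_sesq : Continuous fun z : CVec m × CVec m => sesq M z.1 z.2 := by
  unfold sesq
  exact continuous_snd.inner
    ((LinearMap.continuous_of_finiteDimensional (Matrix.toEuclideanLin M)).comp continuous_fst)

theorem re_inner_comm (ξ η : CVec m) : (inner ℂ ξ η).re = (inner ℂ η ξ).re :=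
  inner_re_symm (𝕜 := ℂ) ξ η

theorem re_inner_smul_left (c : ℝ) (ξ η : CVec m) :
    (inner ℂ (c • ξ) η).re = c * (inner ℂ ξ η).re := by
  rw [RCLike.real_smul_eq_coe_smul (K := ℂ), inner_smul_left]
  simp

theorem re_inner_smul_right (c : ℝ) (ξ η : CVec m) :
    (inner ℂ ξ (c • η)).re = c * (inner ℂ ξ η).re := by
  rw [re_inner_comm, re_inner_smul_left, re_inner_comm]

theorem re_inner_self (ξ : CVec m) : (inner ℂ ξ ξ).re = ‖ξ‖ ^ 2 :=
  inner_self_eq_norm_sq (𝕜 := ℂ) ξ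

/-- `Re ⟨M (ξ + η), p ξ + η⟩ ≥ 0` whenever `Re ⟨ξ, η⟩ = 0`. -/
def TwistNonneg (p : ℝ) (M : Matrix (Fin m) (Fin m) ℂ) : Prop :=
  ∀ ξ η : CVec m, (inner ℂ ξ η).re = 0 → 0 ≤ (sesq M (ξ + η) (p • ξ + η)).re

theorem re_sesq_twist (p : ℝ) (ξ η : CVec m) : (sesq M (ξ + η) (p • ξ + η)).re =
    p * (sesq M ξ ξ).re + (p * (sesq M η ξ).re + (sesq M ξ η).re) + (sesq M η η).re := by
  simp only [sesq_add_left, sesq_add_right, sesq_smul_right, Complex.add_re, Complex.re_ofReal_mul]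
  ring

theorem quadratic_coeff_le {a b c : ℝ} (h : ∀ s t : ℝ, 0 ≤ a * s ^ 2 + b * (s * t) + c * t ^ 2) :
    0 ≤ a ∧ 0 ≤ c ∧ b ^ 2 ≤ 4 * a * c := by
  have h1 := h 1 0
  have h2 := h 0 1
  refine ⟨by linarith, by linarith, ?_⟩
  have h3 : ∀ s : ℝ, 0 ≤ a * (s * s) + b * s + c := fun s => by
    have := h s 1
    linarith
  have := discrim_le_zero h3
  rw [discrim] at this
  linarith

/-- AM-GM: `|b| ≤ 2 √(a c) ≤ a + c`. -/
theorem quadratic_nonneg_of_coeff {a b c : ℝ} (ha : 0 ≤ a) (hc : 0 ≤ c) (h : b ^ 2 ≤ 4 * a * c) :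
    0 ≤ a + b + c := by
  by_contra! hneg
  nlinarith [sq_nonneg (a - c)]

/-- The property `TwistNonneg` is inherited by the parameters between `1` and `p`. -/
theorem TwistNonneg.between {p q : ℝ} {M : Matrix (Fin m) (Fin m) ℂ} (h : TwistNonneg p M)
    (hp : 0 < p) (hq : 1 ≤ q ∧ q ≤ p ∨ p ≤ q ∧ q ≤ 1) : TwistNonneg q M := by
  intro ξ η hξη
  rw [re_sesq_twist]
  set a := (sesq M ξ ξ).re
  set b := (sesq M η ξ).re
  set c := (sesq M ξ η).re
  set d := (sesq M η η).re
  have h1 : ∀ s t : ℝ, 0 ≤ (p * a) * s ^ 2 + (p * b + c) * (s * t) + d * t ^ 2 := by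
    intro s t
    have := h (s • ξ) (t • η) (by
      rw [re_inner_smul_left, re_inner_smul_right, hξη]; ring)
    rw [re_sesq_twist] at this
    simp only [sesq_smul_left, sesq_smul_right, Complex.re_ofReal_mul] at this
    linarith
  -- Orthogonality is symmetric, so `ξ` and `η` may be exchanged; up to scaling this is the
  -- condition for `1 / p`.
  have h2 : ∀ s t : ℝ, 0 ≤ a * s ^ 2 + (b + p * c) * (s * t) + (p * d) * t ^ 2 := by
    intro s t
    have := h (t • η) (s • ξ) (by
      rw [re_inner_smul_left, re_inner_smul_right, re_inner_comm, hξη]; ring)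
    rw [re_sesq_twist] at this
    simp only [sesq_smul_left, sesq_smul_right, Complex.re_ofReal_mul] at this
    linarith
  obtain ⟨_, hd, h3⟩ := quadratic_coeff_le h1
  obtain ⟨ha, _, h4⟩ := quadratic_coeff_le h2
  have hq0 : 0 < q := by rcases hq with hq | hq <;> linarith
  refine quadratic_nonneg_of_coeff (mul_nonneg hq0.le ha) hd ?_
  rcases eq_or_ne p 1 with rfl | hp1
  · have : q = 1 := by rcases hq with hq | hq <;> linarith
    subst this
    linarith
  have hk : 0 ≤ a * d := mul_nonneg ha hd
  have h5 : 0 ≤ (p * q - 1) * (p - q) := by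
    rcases hq with hq | hq
    · exact mul_nonneg (by nlinarith) (by linarith)
    · exact mul_nonneg_of_nonpos_of_nonpos (by nlinarith) (by linarith)
  -- The cross term at `q` is a combination of those at `p` and `1 / p`: `(p² - 1)(q b + c) = (p q -
  -- 1)(p b + c) + (p - q)(b + p c)`. The two coefficients have the same sign by `h5` and sum to `(p
  -- - 1)(q + 1)`; both cross terms are at most `2 √(p a d)` in absolute value.
  have h6 : (p - 1) ^ 2 * ((p + 1) ^ 2 * (q * b + c) ^ 2) ≤
      (p - 1) ^ 2 * (4 * p * (a * d) * (q + 1) ^ 2) := by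
    have e1 : (p - 1) ^ 2 * ((p + 1) ^ 2 * (q * b + c) ^ 2) =
        (p * q - 1) ^ 2 * (p * b + c) ^ 2 + (p - q) ^ 2 * (b + p * c) ^ 2
          + ((p * q - 1) * (p - q)) * (2 * (p * b + c) * (b + p * c)) := by ring
    have e2 : (p - 1) ^ 2 * (4 * p * (a * d) * (q + 1) ^ 2) =
        (p * q - 1) ^ 2 * (4 * (p * a) * d) + (p - q) ^ 2 * (4 * a * (p * d))
          + ((p * q - 1) * (p - q)) * (4 * (p * a) * d + 4 * a * (p * d)) := by ring
    rw [e1, e2]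
    gcongr
    nlinarith [sq_nonneg (p * b + c - (b + p * c))]
  have h7 := le_of_mul_le_mul_left h6 (sq_pos_of_ne_zero (sub_ne_zero.2 hp1))
  -- `q (p + 1)² - p (q + 1)² = (p q - 1)(p - q)`.
  have h8 : 4 * p * (a * d) * (q + 1) ^ 2 ≤ (p + 1) ^ 2 * (4 * (q * a) * d) := by
    nlinarith [mul_nonneg hk h5]
  exact le_of_mul_le_mul_left (h7.trans h8) (by positivity)

/-- With `t = Re ⟨ξ, ω⟩`, the three terms are the expansion of one value of the form, at vectors
differing only along `ω`. This is the bridge to `TwistNonneg`. -/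
theorem formP_eq (L : ℝ) (ξ ω : CVec m) : formP L M ξ ω =
    (sesq M (ξ + (L * (inner ℂ ω ξ).re) • ω) (ξ + (-(L * (inner ℂ ω ξ).re)) • ω)).re := by
  simp only [formP, sesq_add_left, sesq_add_right, sesq_smul_left, sesq_smul_right, Complex.add_re,
    Complex.re_ofReal_mul, Complex.sub_re]
  ring

theorem formP_sub_smul_one (L κ : ℝ) (ξ : CVec m) {ω : CVec m} (hω : ‖ω‖ = 1) :
    formP L (M - (κ : ℂ) • 1) ξ ω =
      formP L M ξ ω - κ * (‖ξ‖ ^ 2 - L ^ 2 * (inner ℂ ω ξ).re ^ 2) := by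
  have h1 := re_inner_self ξ
  have h2 := re_inner_self ω
  have h3 := re_inner_comm ω ξ
  rw [hω] at h2
  simp only [formP, sesq_sub_smul_one, Complex.sub_re, Complex.re_ofReal_mul, h1, h2, h3]
  ring

theorem continuous_formP (L : ℝ) : Continuous fun z : CVec m × CVec m => formP L M z.1 z.2 := by
  have h (f g : CVec m × CVec m → CVec m) (hf : Continuous f) (hg : Continuous g) :
      Continuous fun z => (sesq M (f z) (g z)).re := by
    have := (continuous_sesq M).comp (hf.prodMk hg)
    exact Complex.continuous_re.comp this
  have hi : Continuous fun z : CVec m × CVec m => (inner ℂ z.2 z.1).re := by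
    have : Continuous fun z : CVec m × CVec m => inner ℂ z.2 z.1 :=
      continuous_snd.inner continuous_fst
    exact Complex.continuous_re.comp this
  simp only [formP_eq]
  exact h _ _ (continuous_fst.add ((continuous_const.mul hi).smul continuous_snd))
    (continuous_fst.add ((continuous_const.mul hi).neg.smul continuous_snd))

theorem formP_smul (L c : ℝ) (ξ ω : CVec m) : formP L M (c • ξ) ω = c ^ 2 * formP L M ξ ω := by
  simp only [formP, sesq_smul_left, sesq_smul_right, re_inner_smul_right, Complex.re_ofReal_mul,
    Complex.sub_re]
  ring

theorem exists_unit_parallel {ξ η : CVec m} (h : (inner ℂ ξ η).re = 0) :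
    (ξ = 0 ∧ η = 0) ∨ ∃ (ω : CVec m) (c : ℝ), ‖ω‖ = 1 ∧ ξ = c • ω ∧ (inner ℂ ω η).re = 0 := by
  by_cases hξ : ξ = 0
  · rcases eq_or_ne η 0 with hη | hη
    · exact Or.inl ⟨hξ, hη⟩
    -- `i η` is real-orthogonal to `η`, so a unit vector orthogonal to `η` exists even for `m = 1`.
    · refine Or.inr ⟨(‖η‖⁻¹ : ℝ) • (Complex.I • η), 0, ?_, by rw [hξ, zero_smul], ?_⟩
      · rw [norm_smul, norm_smul, norm_inv, norm_norm, Complex.norm_I, one_mul,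
          inv_mul_cancel₀ (norm_ne_zero_iff.2 hη)]
      · rw [re_inner_smul_left, inner_smul_left, inner_self_eq_norm_sq_to_K]
        simp [← Complex.ofReal_pow]
  · refine Or.inr ⟨(‖ξ‖⁻¹ : ℝ) • ξ, ‖ξ‖, ?_, ?_, ?_⟩
    · rw [norm_smul, norm_inv, norm_norm, inv_mul_cancel₀ (norm_ne_zero_iff.2 hξ)]
    · rw [smul_smul, mul_inv_cancel₀ (norm_ne_zero_iff.2 hξ), one_smul]
    · rw [re_inner_smul_left, h, mul_zero]

/-- Positivity of `formP L` amounts to `TwistNonneg ((1 - L) / (1 + L))`. -/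
theorem twistNonneg_iff_formP {L : ℝ} (hL : L ^ 2 < 1) :
    TwistNonneg ((1 - L) / (1 + L)) M ↔ ∀ ξ ω : CVec m, ‖ω‖ = 1 → 0 ≤ formP L M ξ ω := by
  have hL1 : 0 < 1 + L := by nlinarith
  constructor
  · intro h ξ ω hω
    set t := (inner ℂ ω ξ).re with ht
    -- Enlarging the `ω`-component `t ω` of `ξ` by the factor `1 + L` gives total `ξ + L t ω`; the
    -- twist then turns `1 + L` into `1 - L`, giving `ξ - L t ω`.
    have h0 : (inner ℂ (((1 + L) * t) • ω) (ξ + (-t) • ω)).re = 0 := by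
      rw [inner_add_right, Complex.add_re, re_inner_smul_left, re_inner_smul_left,
        re_inner_smul_right, re_inner_self, hω, ← ht]
      ring
    have h1 := h _ _ h0
    rw [formP_eq, ← ht]
    convert h1 using 3
    · module
    · rw [smul_smul, ← mul_assoc, div_mul_cancel₀ _ hL1.ne']
      module
  · intro h ξ η hξη
    rcases exists_unit_parallel hξη with ⟨rfl, rfl⟩ | ⟨ω, c, hω, rfl, h0⟩
    · simp [sesq_zero_left]
    have h1 := h ((c / (1 + L)) • ω + η) ω hω
    have h2 : (inner ℂ ω ((c / (1 + L)) • ω + η)).re = c / (1 + L) := by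
      rw [inner_add_right, Complex.add_re, re_inner_smul_right, re_inner_self, hω, h0]
      ring
    rw [formP_eq, h2] at h1
    convert h1 using 3
    · have : c = c / (1 + L) + L * (c / (1 + L)) := by field_simp
      nth_rewrite 1 [this]
      module
    · have : (1 - L) / (1 + L) * c = c / (1 + L) + -(L * (c / (1 + L))) := by
        field_simp
        ring
      rw [smul_smul, this]
      module

end Sesq

/-! ### The parameter `p(s)` and its limit at infinity. -/

/-- The logarithmic derivative `(s φ(s))' / φ(s) = 1 + s φ'(s) / φ(s)`. -/
def twistParam (φ : ℝ → ℝ) (s : ℝ) : ℝ := 1 + s * deriv φ s / φ s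

/-- The limit of `twistParam φ` at infinity, expressed through `Λ_∞`. -/
def twistParamInf (φ : ℝ → ℝ) : ℝ := (1 - capLambdaInf φ) / (1 + capLambdaInf φ)

namespace PhiAdmissible

variable {φ : ℝ → ℝ}

theorem continuousOn_deriv (hφ : PhiAdmissible φ) : ContinuousOn (deriv φ) (Ioi 0) :=
  hφ.contDiffOn.continuousOn_deriv_of_isOpen isOpen_Ioi le_rfl

theorem hasDerivAt (hφ : PhiAdmissible φ) {s : ℝ} (hs : 0 < s) : HasDerivAt φ (deriv φ s) s :=
  ((hφ.contDiffOn.differentiableOn one_ne_zero).differentiableAt (Ioi_mem_nhds hs)).hasDerivAt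

theorem twistParam_mul (hφ : PhiAdmissible φ) {s : ℝ} (hs : 0 < s) : twistParam φ s * φ s = φ s + s * deriv φ s := by
  have := (hφ.pos s hs).ne'
  rw [twistParam]
  field_simp

theorem continuousOn_twistParam (hφ : PhiAdmissible φ) : ContinuousOn (twistParam φ) (Ioi 0) :=
  continuousOn_const.add ((continuousOn_id.mul hφ.continuousOn_deriv).div
    hφ.contDiffOn.continuousOn fun s hs => (hφ.pos s hs).ne')

theorem tendsto_mul_sqrt (hφ : PhiAdmissible φ) : Tendsto (fun s => s * √(φ s)) atTop atTop := by
  rw [tendsto_atTop]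
  intro N
  obtain ⟨c, hc, hcN⟩ := hφ.surjOn_mul_sqrt (mem_Ioi.2 (lt_of_lt_of_le one_pos (le_max_right N 1)))
  filter_upwards [eventually_ge_atTop c] with s hs
  have hs0 : s ∈ Ioi (0 : ℝ) := lt_of_lt_of_le hc hs
  have := hφ.strictMonoOn_mul_sqrt.monotoneOn hc hs0 hs
  simp only at this hcN
  exact (le_max_left N 1).trans (hcN ▸ this)

/-- The definition of `Λ` reads `Λ = (1 - p) / (1 + p)`, and this Möbius map is its own inverse. -/
theorem twistParam_eq (hφ : PhiAdmissible φ) {s : ℝ} (hs : 0 < s) : twistParam φ s =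
    (1 - capLambda φ (s * √(φ s))) / (1 + capLambda φ (s * √(φ s))) := by
  have h1 := hφ.pos s hs
  have h2 := hφ.deriv_mul hs
  have h3 : 0 < s * deriv φ s + 2 * φ s := by linarith
  rw [capLambda_apply hφ hs, twistParam]
  have h4 : 1 + -(s * deriv φ s) / (s * deriv φ s + 2 * φ s) =
      2 * φ s / (s * deriv φ s + 2 * φ s) := by
    field_simp
    ring
  have h5 : 1 - -(s * deriv φ s) / (s * deriv φ s + 2 * φ s) =
      (2 * (φ s + s * deriv φ s)) / (s * deriv φ s + 2 * φ s) := by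
    field_simp
    ring
  rw [h4, h5, div_div_div_cancel_right₀ h3.ne']
  field_simp

theorem tendsto_twistParam (hφ : PhiAdmissible φ) (hΛ : capLambdaInf φ ^ 2 < 1) :
    Tendsto (twistParam φ) atTop (𝓝 (twistParamInf φ)) := by
  have h1 := (tendsto_capLambda hφ).comp hφ.tendsto_mul_sqrt
  have h2 := (h1.const_sub 1).div (h1.const_add 1) (by nlinarith)
  refine h2.congr' ?_
  filter_upwards [eventually_gt_atTop 0] with s hs
  exact (hφ.twistParam_eq hs).symm

/-- Condition (vi) says that `|p - 1|` is non-decreasing. Once `p ≠ 1` it never returns to `1`, so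
by continuity `p - 1` keeps its sign and `p` moves monotonically away from `1` towards its limit. -/
theorem twistParam_between (hφ : PhiAdmissible φ) (hΛ : capLambdaInf φ ^ 2 < 1) {s : ℝ} (hs : 0 < s) :
    1 ≤ twistParam φ s ∧ twistParam φ s ≤ twistParamInf φ ∨
      twistParamInf φ ≤ twistParam φ s ∧ twistParam φ s ≤ 1 := by
  have hlim := hφ.tendsto_twistParam hΛ
  have habs : ∀ t, s ≤ t → |twistParam φ s - 1| ≤ |twistParam φ t - 1| := fun t ht => by
    have := hφ.monotone hs (hs.trans_le ht) ht
    simpa [twistParam] using this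
  rcases eq_or_ne (twistParam φ s) 1 with h1 | h1
  · rw [h1]
    simpa using le_total 1 (twistParamInf φ)
  have hne : ∀ t ∈ Ici s, twistParam φ t ≠ 1 := fun t ht h => by
    have := habs t ht
    rw [h, sub_self, abs_zero, abs_nonpos_iff, sub_eq_zero] at this
    exact h1 this
  have hcont : ContinuousOn (twistParam φ) (Ici s) :=
    hφ.continuousOn_twistParam.mono fun t ht => lt_of_lt_of_le hs ht
  have hpre := isPreconnected_Ici.image _ hcont
  rcases h1.lt_or_gt with h | h
  · right
    refine ⟨le_of_tendsto hlim ?_, h.le⟩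
    filter_upwards [eventually_ge_atTop s] with t ht
    have ht1 : twistParam φ t < 1 := by
      by_contra! hc
      obtain ⟨y, hy, hy1⟩ := hpre.ordConnected.out (mem_image_of_mem _ self_mem_Ici)
        (mem_image_of_mem _ ht) ⟨h.le, hc⟩
      exact hne y hy hy1
    have := habs t ht
    rw [abs_of_neg (by linarith), abs_of_neg (by linarith)] at this
    linarith
  · left
    refine ⟨h.le, ge_of_tendsto hlim ?_⟩
    filter_upwards [eventually_ge_atTop s] with t ht
    have ht1 : 1 < twistParam φ t := by
      by_contra! hc
      obtain ⟨y, hy, hy1⟩ := hpre.ordConnected.out (mem_image_of_mem _ ht)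
        (mem_image_of_mem _ self_mem_Ici) ⟨hc, h.le⟩
      exact hne y hy hy1
    have := habs t ht
    rw [abs_of_pos (by linarith), abs_of_pos (by linarith)] at this
    linarith

end PhiAdmissible

theorem twistParamInf_pos {φ : ℝ → ℝ} (hΛ : capLambdaInf φ ^ 2 < 1) : 0 < twistParamInf φ :=
  div_pos (by nlinarith) (by nlinarith)

/-! ### Derivatives of radial multiples of `u`, and the zero set of `u`. -/

section Deriv

variable {m : ℕ} {u : ℝ → CVec m} {u' : CVec m} {x : ℝ}

theorem hasDerivAt_norm_of_ne (hu : HasDerivAt u u' x) (hx : u x ≠ 0) :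
    HasDerivAt (fun y => ‖u y‖) ((inner ℂ (u x) u').re / ‖u x‖) x := by
  have h1 : HasDerivAt (fun y => ‖u y‖ ^ 2) (2 * (inner ℂ (u x) u').re) x := by
    have h := (hu.inner ℂ hu)
    have h' := Complex.reCLM.hasFDerivAt.comp_hasDerivAt x h
    have h2 : ∀ y, (inner ℂ (u y) (u y)).re = ‖u y‖ ^ 2 := fun y => re_inner_self _
    have h3 : 2 * (inner ℂ (u x) u').re = Complex.reCLM (inner ℂ (u x) u' + inner ℂ u' (u x)) := by
      rw [Complex.reCLM_apply, Complex.add_re, re_inner_comm u']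
      ring
    rw [h3]
    exact h'.congr_of_eventuallyEq (Eventually.of_forall fun y => (h2 y).symm)
  have hn : (0 : ℝ) < ‖u x‖ := norm_pos_iff.2 hx
  have h3 := h1.sqrt (by positivity)
  simp only [Real.sqrt_sq (norm_nonneg _)] at h3
  convert h3 using 1
  field_simp

theorem hasDerivAt_comp_norm_smul {ψ : ℝ → ℝ} {ψ' : ℝ} (hu : HasDerivAt u u' x) (hx : u x ≠ 0)
    (hψ : HasDerivAt ψ ψ' ‖u x‖) :
    HasDerivAt (fun y => ψ ‖u y‖ • u y)
      (ψ ‖u x‖ • u' + (ψ' * ((inner ℂ (u x) u').re / ‖u x‖)) • u x) x :=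
  (hψ.comp x (hasDerivAt_norm_of_ne hu hx)).smul hu

/-- At almost every zero of a function its `deriv` vanishes. -/
theorem ae_deriv_eq_zero_of_eq_zero (u : ℝ → CVec m) : ∀ᵐ x, u x = 0 → deriv u x = 0 := by
  -- Only countably many zeros are isolated from the right; at any other zero the difference
  -- quotients vanish along zeros tending to it.
  have hc := (countable_setOfPred_isolated_right_within (s := {x | u x = 0}))
  filter_upwards [hc.ae_notMem volume] with x hx hux
  by_cases hd : DifferentiableAt ℝ u x
  · have hne : (𝓝[{x | u x = 0} ∩ Ioi x] x).NeBot := by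
      rw [neBot_iff]
      intro h
      exact hx ⟨hux, h⟩
    have h1 := (hasDerivAt_iff_tendsto_slope.1 hd.hasDerivAt).mono_left
      (nhdsWithin_mono x (show {x | u x = 0} ∩ Ioi x ⊆ {x}ᶜ from fun y hy => ne_of_gt hy.2))
    refine tendsto_nhds_unique h1 (tendsto_const_nhds.congr' ?_)
    filter_upwards [self_mem_nhdsWithin] with y hy
    have hy0 : u y = 0 := hy.1
    simp [slope, hux, hy0]
  -- Without differentiability `deriv` takes the default value `0`, so no regularity of `u` is
  -- required.
  · exact deriv_zero_of_not_differentiableAt hd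

end Deriv

/-! ### Pointwise identities and inequalities where `u ≠ 0`. -/

section Pointwise

variable {m : ℕ}

/-- The real orthogonal projection of `ξ` to the line spanned by `y`. -/
def radialPart (y ξ : CVec m) : CVec m := ((inner ℂ y ξ).re / ‖y‖ ^ 2) • y

theorem re_inner_radialPart_sub {y : CVec m} (ξ : CVec m) (hy : y ≠ 0) :
    (inner ℂ (radialPart y ξ) (ξ - radialPart y ξ)).re = 0 := by
  have hn : ‖y‖ ≠ 0 := norm_ne_zero_iff.2 hy
  rw [radialPart, re_inner_smul_left, inner_sub_right, Complex.sub_re, re_inner_smul_right,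
    re_inner_self]
  field_simp
  ring

theorem norm_sq_smul_add_smul {ξ η : CVec m} (h : (inner ℂ ξ η).re = 0) (c : ℝ) :
    ‖c • ξ + η‖ ^ 2 = c ^ 2 * ‖ξ‖ ^ 2 + ‖η‖ ^ 2 := by
  have h' := re_inner_comm ξ η
  simp only [← re_inner_self, inner_add_left, inner_add_right, Complex.add_re, re_inner_smul_left,
    re_inner_smul_right, ← h', h]
  ring

theorem re_inner_smul_add {ξ η : CVec m} (h : (inner ℂ ξ η).re = 0) (c : ℝ) :
    (inner ℂ (c • ξ + η) (ξ + η)).re = c * ‖ξ‖ ^ 2 + ‖η‖ ^ 2 := by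
  have h' := re_inner_comm ξ η
  simp only [← re_inner_self, inner_add_left, inner_add_right, Complex.add_re, re_inner_smul_left,
    ← h', h]
  ring

variable {φ : ℝ → ℝ} {u : ℝ → CVec m} {u' : CVec m} {x : ℝ}

theorem PhiAdmissible.hasDerivAt_smul (hφ : PhiAdmissible φ) (hu : HasDerivAt u u' x)
    (hx : u x ≠ 0) :
    HasDerivAt (fun y => φ ‖u y‖ • u y) (φ ‖u x‖ •
      (twistParam φ ‖u x‖ • radialPart (u x) u' + (u' - radialPart (u x) u'))) x := by
  have hn : 0 < ‖u x‖ := norm_pos_iff.2 hx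
  have hp := hφ.twistParam_mul hn
  convert hasDerivAt_comp_norm_smul hu hx (hφ.hasDerivAt hn) using 1
  have h1 : deriv φ ‖u x‖ * ((inner ℂ (u x) u').re / ‖u x‖) =
      (φ ‖u x‖ * (twistParam φ ‖u x‖ - 1)) * ((inner ℂ (u x) u').re / ‖u x‖ ^ 2) := by
    rw [mul_sub, mul_one, mul_comm (φ _), hp]
    field_simp
    ring
  rw [h1, radialPart]
  module

/-- The radial factor is `(s √φ(s))' = √φ (1 + p) / 2`, the tangential one is `√φ`. -/
theorem PhiAdmissible.hasDerivAt_sqrt_smul (hφ : PhiAdmissible φ) (hu : HasDerivAt u u' x)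
    (hx : u x ≠ 0) :
    HasDerivAt (fun y => √(φ ‖u y‖) • u y) (√(φ ‖u x‖) •
      (((1 + twistParam φ ‖u x‖) / 2) • radialPart (u x) u' + (u' - radialPart (u x) u'))) x := by
  have hn : 0 < ‖u x‖ := norm_pos_iff.2 hx
  have hφ0 := hφ.pos _ hn
  have hp := hφ.twistParam_mul hn
  convert hasDerivAt_comp_norm_smul hu hx ((hφ.hasDerivAt hn).sqrt hφ0.ne') using 1
  have h1 : deriv φ ‖u x‖ / (2 * √(φ ‖u x‖)) * ((inner ℂ (u x) u').re / ‖u x‖) =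
      (√(φ ‖u x‖) * ((1 + twistParam φ ‖u x‖) / 2 - 1)) *
        ((inner ℂ (u x) u').re / ‖u x‖ ^ 2) := by
    have h2 : deriv φ ‖u x‖ = φ ‖u x‖ * (twistParam φ ‖u x‖ - 1) / ‖u x‖ := by
      rw [mul_sub, mul_one, mul_comm (φ _), hp]
      field_simp
      ring
    have h3 := Real.sq_sqrt hφ0.le
    have h4 : 0 < √(φ ‖u x‖) := Real.sqrt_pos.2 hφ0
    rw [h2]
    nth_rewrite 1 [← h3]
    field_simp
    ring
  rw [h1, radialPart]
  module

/-- The pointwise content of sufficiency: where `u` is differentiable and does not vanish, the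
form is nonnegative. -/
theorem PhiAdmissible.re_sesq_nonneg (hφ : PhiAdmissible φ) (hΛ : capLambdaInf φ ^ 2 < 1)
    {M : Matrix (Fin m) (Fin m) ℂ} (hM : TwistNonneg (twistParamInf φ) M)
    (hu : HasDerivAt u u' x) (hx : u x ≠ 0) :
    0 ≤ (sesq M u' (deriv (fun y => φ ‖u y‖ • u y) x)).re := by
  have hn : 0 < ‖u x‖ := norm_pos_iff.2 hx
  rw [(hφ.hasDerivAt_smul hu hx).deriv, sesq_smul_right, Complex.re_ofReal_mul]
  refine mul_nonneg (hφ.pos _ hn).le ?_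
  have h := hM.between (twistParamInf_pos hΛ) (hφ.twistParam_between hΛ hn) _ _
    (re_inner_radialPart_sub u' hx)
  rwa [add_sub_cancel] at h

theorem PhiAdmissible.norm_sq_deriv_sqrt_smul (hφ : PhiAdmissible φ) (hu : HasDerivAt u u' x)
    (hx : u x ≠ 0) : ‖deriv (fun y => √(φ ‖u y‖) • u y) x‖ ^ 2 =
      φ ‖u x‖ * (((1 + twistParam φ ‖u x‖) / 2) ^ 2 * ‖radialPart (u x) u'‖ ^ 2 +
        ‖u' - radialPart (u x) u'‖ ^ 2) := by
  rw [(hφ.hasDerivAt_sqrt_smul hu hx).deriv, norm_smul, mul_pow, Real.norm_eq_abs, sq_abs,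
    Real.sq_sqrt (hφ.pos _ (norm_pos_iff.2 hx)).le,
    norm_sq_smul_add_smul (re_inner_radialPart_sub u' hx)]

theorem PhiAdmissible.re_inner_deriv_smul (hφ : PhiAdmissible φ) (hu : HasDerivAt u u' x)
    (hx : u x ≠ 0) : (inner ℂ (deriv (fun y => φ ‖u y‖ • u y) x) u').re =
      φ ‖u x‖ * (twistParam φ ‖u x‖ * ‖radialPart (u x) u'‖ ^ 2 +
        ‖u' - radialPart (u x) u'‖ ^ 2) := by
  rw [(hφ.hasDerivAt_smul hu hx).deriv, re_inner_smul_left,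
    ← re_inner_smul_add (re_inner_radialPart_sub u' hx), add_sub_cancel]

/-- The tangential parts agree, and radially `p ≤ ((1 + p) / 2)²`. -/
theorem PhiAdmissible.re_inner_le_norm_sq (hφ : PhiAdmissible φ) (hu : HasDerivAt u u' x)
    (hx : u x ≠ 0) : (inner ℂ (deriv (fun y => φ ‖u y‖ • u y) x) u').re ≤
      ‖deriv (fun y => √(φ ‖u y‖) • u y) x‖ ^ 2 := by
  rw [hφ.norm_sq_deriv_sqrt_smul hu hx, hφ.re_inner_deriv_smul hu hx]
  have := (hφ.pos _ (norm_pos_iff.2 hx)).le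
  gcongr
  nlinarith [sq_nonneg (twistParam φ ‖u x‖ - 1)]

/-- The radial ratio `(1 + p)² / (4 p)` is at least `1` and grows as `p` moves away from `1` on
either side, hence is largest at `P`; the comparison reduces to `(P p - 1)(P - p) ≥ 0`. -/
theorem PhiAdmissible.norm_sq_le_re_inner (hφ : PhiAdmissible φ) (hΛ : capLambdaInf φ ^ 2 < 1)
    (hu : HasDerivAt u u' x) (hx : u x ≠ 0) : ‖deriv (fun y => √(φ ‖u y‖) • u y) x‖ ^ 2 ≤
      (1 + twistParamInf φ) ^ 2 / (4 * twistParamInf φ) *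
        (inner ℂ (deriv (fun y => φ ‖u y‖ • u y) x) u').re := by
  have hn : 0 < ‖u x‖ := norm_pos_iff.2 hx
  rw [hφ.norm_sq_deriv_sqrt_smul hu hx, hφ.re_inner_deriv_smul hu hx, mul_left_comm]
  refine mul_le_mul_of_nonneg_left ?_ (hφ.pos _ hn).le
  have hb := hφ.twistParam_between hΛ hn
  have hP := twistParamInf_pos hΛ
  set p := twistParam φ ‖u x‖
  set P := twistParamInf φ
  have h1 : 1 ≤ (1 + P) ^ 2 / (4 * P) := by
    rw [le_div_iff₀ (by positivity)]
    nlinarith [sq_nonneg (P - 1)]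
  have h2 : ((1 + p) / 2) ^ 2 ≤ (1 + P) ^ 2 / (4 * P) * p := by
    rw [div_mul_eq_mul_div, le_div_iff₀ (by positivity)]
    have h3 : 0 ≤ (P * p - 1) * (P - p) := by
      rcases hb with hb | hb
      · exact mul_nonneg (by nlinarith) (by linarith)
      · exact mul_nonneg_of_nonpos_of_nonpos (by nlinarith) (by linarith)
    nlinarith
  rw [mul_add, ← mul_assoc]
  gcongr
  exact le_mul_of_one_le_left (sq_nonneg _) h1

end Pointwise

/-! ### Integrated form: sufficiency, and strict dissipativity as dissipativity of `𝒜 - κ`. -/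

section Integral

variable {m : ℕ} {I : Set ℝ} {𝒜 : ℝ → Matrix (Fin m) (Fin m) ℂ}

theorem isOpen_openInterval (a b : EReal) : IsOpen (openInterval a b) :=
  (isOpen_lt continuous_const continuous_coe_real_ereal).inter
    (isOpen_lt continuous_coe_real_ereal continuous_const)

theorem integrable_sesq (h𝒜 : ∀ i j, LocallyIntegrableOn (fun x => 𝒜 x i j) I volume)
    {f g : ℝ → CVec m} (hf : Continuous f) (hg : Continuous g) (hfc : HasCompactSupport f)
    (hfI : tsupport f ⊆ I) : Integrable fun x => sesq (𝒜 x) (f x) (g x) := by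
  have hs : Function.support (fun x => sesq (𝒜 x) (f x) (g x)) ⊆ tsupport f := fun x hx => by
    refine subset_tsupport f fun h => hx ?_
    simp only [h, sesq_zero_left]
  rw [← integrableOn_iff_integrable_of_support_subset hs]
  simp only [sesq_eq_sum]
  refine integrable_finsetSum _ fun i _ => integrable_finsetSum _ fun j _ => ?_
  refine (((h𝒜 i j).integrableOn_compact_subset hfI hfc).mul_continuousOn ?_ hfc).mul_continuousOn
    ?_ hfc
  · exact ((EuclideanSpace.proj (𝕜 := ℂ) j).continuous.comp hf).continuousOn
  · exact (Complex.continuous_conj.comp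
      ((EuclideanSpace.proj (𝕜 := ℂ) i).continuous.comp hg)).continuousOn

theorem IsC1c.deriv {u : ℝ → CVec m} (hu : IsC1c I u) :
    Continuous (deriv u) ∧ HasCompactSupport (deriv u) ∧ tsupport (deriv u) ⊆ I :=
  ⟨hu.1.continuous_deriv le_rfl, hu.2.1.deriv, tsupport_deriv_subset.trans hu.2.2⟩

theorem IsC1c.hasDerivAt {u : ℝ → CVec m} (hu : IsC1c I u) (x : ℝ) :
    HasDerivAt u (_root_.deriv u x) x :=
  (hu.1.differentiable one_ne_zero x).hasDerivAt

theorem IsC1c.integrable_sesq (h𝒜 : ∀ i j, LocallyIntegrableOn (fun x => 𝒜 x i j) I volume)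
    {u w : ℝ → CVec m} (hu : IsC1c I u) (hw : IsC1c I w) :
    Integrable fun x => sesq (𝒜 x) (_root_.deriv u x) (_root_.deriv w x) :=
  _root_.integrable_sesq h𝒜 hu.deriv.1 hw.deriv.1 hu.deriv.2.1 hu.deriv.2.2

theorem IsC1c.integrable_inner {u w : ℝ → CVec m} (hu : IsC1c I u) (hw : IsC1c I w) :
    Integrable fun x => inner ℂ (_root_.deriv w x) (_root_.deriv u x) := by
  refine Continuous.integrable_of_hasCompactSupport (hw.deriv.1.inner hu.deriv.1) ?_
  refine hu.deriv.2.1.mono fun x hx h => hx ?_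
  simp only [h, inner_zero_right]

variable {φ : ℝ → ℝ}

/-- Sufficiency of the algebraic condition. -/
theorem PhiAdmissible.isPhiDissipative (hφ : PhiAdmissible φ) (hΛ : capLambdaInf φ ^ 2 < 1)
    (h𝒜 : ∀ i j, LocallyIntegrableOn (fun x => 𝒜 x i j) I volume)
    (h : ∀ᵐ x ∂(volume.restrict I), TwistNonneg (twistParamInf φ) (𝒜 x)) :
    IsPhiDissipative φ I 𝒜 := by
  intro u hu hw
  have hint := (hu.integrable_sesq h𝒜 hw).restrict (s := I)
  have h0 : (∫ x in I, sesq (𝒜 x) (deriv u x) (deriv (fun y => φ ‖u y‖ • u y) x)).re =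
      ∫ x in I, (sesq (𝒜 x) (deriv u x) (deriv (fun y => φ ‖u y‖ • u y) x)).re :=
    (integral_re hint).symm
  rw [h0]
  refine integral_nonneg_of_ae ?_
  filter_upwards [h, ae_restrict_of_ae (ae_deriv_eq_zero_of_eq_zero u)] with x hx hx0
  by_cases hux : u x = 0
  · simp only [hx0 hux, sesq_zero_left, Complex.zero_re, Pi.zero_apply, le_refl]
  · exact hφ.re_sesq_nonneg hΛ hx (hu.hasDerivAt x) hux

theorem PhiAdmissible.ae_re_inner_le (hφ : PhiAdmissible φ) {u : ℝ → CVec m} (hu : IsC1c I u) :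
    ∀ᵐ x, (inner ℂ (deriv (fun y => φ ‖u y‖ • u y) x) (deriv u x)).re ≤
      ‖deriv (fun y => √(φ ‖u y‖) • u y) x‖ ^ 2 := by
  filter_upwards [ae_deriv_eq_zero_of_eq_zero u] with x hx
  by_cases hux : u x = 0
  · simp [hx hux]
  · exact hφ.re_inner_le_norm_sq (hu.hasDerivAt x) hux

/-- The function `√φ(|u|) u` need not be differentiable at zeros of `u`, but it vanishes there too,
so its `deriv` is `0` at almost all of them. -/
theorem PhiAdmissible.ae_norm_sq_le (hφ : PhiAdmissible φ) (hΛ : capLambdaInf φ ^ 2 < 1)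
    {u : ℝ → CVec m} (hu : IsC1c I u) : ∀ᵐ x, ‖deriv (fun y => √(φ ‖u y‖) • u y) x‖ ^ 2 ≤
      (1 + twistParamInf φ) ^ 2 / (4 * twistParamInf φ) *
        (inner ℂ (deriv (fun y => φ ‖u y‖ • u y) x) (deriv u x)).re := by
  filter_upwards [ae_deriv_eq_zero_of_eq_zero u,
    ae_deriv_eq_zero_of_eq_zero fun y => √(φ ‖u y‖) • u y] with x hx hx'
  by_cases hux : u x = 0
  · simp [hx hux, hx' (by simp [hux])]
  · exact hφ.norm_sq_le_re_inner hΛ (hu.hasDerivAt x) hux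

theorem IsC1c.integral_sub_smul_one (h𝒜 : ∀ i j, LocallyIntegrableOn (fun x => 𝒜 x i j) I volume)
    {u w : ℝ → CVec m} (hu : IsC1c I u) (hw : IsC1c I w) (κ : ℝ) :
    (∫ x in I, sesq (𝒜 x - (κ : ℂ) • 1) (_root_.deriv u x) (_root_.deriv w x)).re =
      (∫ x in I, sesq (𝒜 x) (_root_.deriv u x) (_root_.deriv w x)).re -
        κ * ∫ x in I, (inner ℂ (_root_.deriv w x) (_root_.deriv u x)).re := by
  have h1 := (hu.integrable_sesq h𝒜 hw).restrict (s := I)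
  have h2 := (hu.integrable_inner hw).restrict (s := I)
  have h3 : (∫ x in I, inner ℂ (_root_.deriv w x) (_root_.deriv u x)).re =
      ∫ x in I, (inner ℂ (_root_.deriv w x) (_root_.deriv u x)).re := (integral_re h2).symm
  simp only [sesq_sub_smul_one]
  rw [integral_sub h1 (h2.const_mul _), integral_const_mul, Complex.sub_re, Complex.re_ofReal_mul,
    h3]

/-- Strict dissipativity is dissipativity of `𝒜 - κ` for some `κ > 0`. -/
theorem PhiAdmissible.isStrictPhiDissipative_iff (hφ : PhiAdmissible φ)
    (hΛ : capLambdaInf φ ^ 2 < 1)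
    (h𝒜 : ∀ i j, LocallyIntegrableOn (fun x => 𝒜 x i j) I volume) :
    IsStrictPhiDissipative φ I 𝒜 ↔
      ∃ κ : ℝ, 0 < κ ∧ IsPhiDissipative φ I (fun x => 𝒜 x - (κ : ℂ) • 1) := by
  set C := (1 + twistParamInf φ) ^ 2 / (4 * twistParamInf φ) with hC
  have hP := twistParamInf_pos hΛ
  have hC0 : 0 < C := by positivity
  have hgi : ∀ {u w : ℝ → CVec m}, IsC1c I u → IsC1c I w →
      Integrable (fun x => (inner ℂ (deriv w x) (deriv u x)).re) (volume.restrict I) :=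
    fun hu hw => (hu.integrable_inner hw).restrict.re
  -- Integrability comes from domination by the continuous, compactly supported `C Re ⟨u', (φ(|u|)
  -- u)'⟩`.
  have hvi : ∀ {u : ℝ → CVec m}, IsC1c I u → IsC1c I (fun x => φ ‖u x‖ • u x) →
      Integrable (fun x => ‖deriv (fun y => √(φ ‖u y‖) • u y) x‖ ^ 2) (volume.restrict I) := by
    intro u hu hw
    refine ((hgi hu hw).const_mul C).mono' ?_ ?_
    · exact ((measurable_deriv _).norm.pow_const 2).aestronglyMeasurable
    · filter_upwards [ae_restrict_of_ae (hφ.ae_norm_sq_le hΛ hu)] with x hx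
      rwa [Real.norm_of_nonneg (sq_nonneg _)]
  constructor
  · rintro ⟨κ, hκ, h⟩
    refine ⟨κ, hκ, fun u hu hw => ?_⟩
    rw [hu.integral_sub_smul_one h𝒜 hw]
    have h1 := h u hu hw
    have h2 := integral_mono_ae (hgi hu hw) (hvi hu hw)
      (ae_restrict_of_ae (hφ.ae_re_inner_le hu))
    have := mul_le_mul_of_nonneg_left h2 hκ.le
    linarith
  · rintro ⟨κ, hκ, h⟩
    refine ⟨κ / C, by positivity, fun u hu hw => ?_⟩
    have h1 := h u hu hw
    rw [hu.integral_sub_smul_one h𝒜 hw] at h1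
    have h2 := integral_mono_ae (hvi hu hw) ((hgi hu hw).const_mul C)
      (ae_restrict_of_ae (hφ.ae_norm_sq_le hΛ hu))
    rw [integral_const_mul] at h2
    have h3 := mul_le_mul_of_nonneg_left h2 (div_pos hκ hC0).le
    rw [← mul_assoc, div_mul_cancel₀ _ hC0.ne'] at h3
    linarith

end Integral

/-! ### Cutting off to zero although `φ` may be singular at `0`. -/

section Profile

/-- The derivative `2 t F'(t²)` is at most `2 |t|`, so it tends to `0` at `t = 0` even if `F'` has
no limit there. -/
theorem contDiff_comp_sq {F F' : ℝ → ℝ} (h0 : ∀ y, 0 ≤ y → |F y| ≤ y)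
    (hF : ∀ y, 0 < y → HasDerivAt F (F' y) y) (hF1 : ∀ y, 0 < y → |F' y| ≤ 1)
    (hc : ContinuousOn F' (Ioi 0)) : ContDiff ℝ 1 fun t => F (t ^ 2) := by
  have hd : ∀ t, HasDerivAt (fun t => F (t ^ 2)) (2 * t * F' (t ^ 2)) t := by
    intro t
    rcases eq_or_ne t 0 with rfl | ht
    · have hF0 : F 0 = 0 := abs_nonpos_iff.1 (h0 0 le_rfl)
      rw [hasDerivAt_iff_isLittleO]
      simp only [ne_eq, OfNat.ofNat_ne_zero, not_false_eq_true, zero_pow, hF0, sub_zero, mul_zero,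
        zero_mul, smul_zero]
      refine Asymptotics.IsBigO.trans_isLittleO (g := fun t : ℝ => t ^ 2) ?_ ?_
      · refine Asymptotics.isBigO_of_le _ fun t => ?_
        rw [Real.norm_eq_abs, Real.norm_of_nonneg (sq_nonneg t)]
        exact h0 _ (sq_nonneg t)
      · exact Asymptotics.isLittleO_pow_id one_lt_two
    · have h := (hF (t ^ 2) (by positivity)).comp t (hasDerivAt_pow 2 t)
      have e : F' (t ^ 2) * (((2 : ℕ) : ℝ) * t ^ (2 - 1)) = 2 * t * F' (t ^ 2) := by
        norm_num
        ring
      rw [e] at h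
      exact h
  rw [contDiff_one_iff_deriv]
  refine ⟨fun t => (hd t).differentiableAt, ?_⟩
  rw [show deriv (fun t => F (t ^ 2)) = fun t => 2 * t * F' (t ^ 2) from funext fun t => (hd t).deriv]
  rw [continuous_iff_continuousAt]
  intro t
  rcases eq_or_ne t 0 with rfl | ht
  · rw [ContinuousAt, mul_zero, zero_mul]
    refine squeeze_zero_norm (a := fun t => |2 * t|) (fun t => ?_) ?_
    · rcases eq_or_ne t 0 with rfl | ht
      · simp
      · rw [norm_mul, Real.norm_eq_abs, Real.norm_eq_abs]
        exact mul_le_of_le_one_right (abs_nonneg _) (hF1 _ (by positivity))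
    · exact (by fun_prop : Continuous fun t : ℝ => |2 * t|).tendsto' 0 0 (by simp)
  · have h1 : ContinuousAt F' (t ^ 2) := hc.continuousAt (Ioi_mem_nhds (by positivity))
    have h2 : ContinuousAt (fun t : ℝ => F' (t ^ 2)) t :=
      ContinuousAt.comp (f := fun t : ℝ => t ^ 2) h1 (by fun_prop)
    exact (by fun_prop : ContinuousAt (fun t : ℝ => 2 * t) t).mul h2

/-- A reparametrisation `k` of `[0, ∞)` for which both `k (t²)` and `φ (k (t²)) k (t²)` are `C¹`. -/
theorem PhiAdmissible.exists_profile {φ : ℝ → ℝ} (hφ : PhiAdmissible φ) :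
    ∃ k : ℝ → ℝ, (∀ t, 0 ≤ k (t ^ 2)) ∧ k 0 = 0 ∧ (∀ R, 0 < R → ∃ t, k (t ^ 2) = R) ∧
      ContDiff ℝ 1 (fun t => k (t ^ 2)) ∧ ContDiff ℝ 1 (fun t => φ (k (t ^ 2)) * k (t ^ 2)) := by
  set h : ℝ → ℝ := fun s => s * φ s with hh
  -- Both `s` and `s φ(s)` are increasing, so as functions of their sum `y = G s` they have
  -- derivatives in `[0, 1]`, namely `1 / (1 + h')` and `h' / (1 + h')`, whatever the behaviour of
  -- `φ` at `0`.
  set G : ℝ → ℝ := fun s => s + h s with hG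
  have hcont : ContinuousOn h (Ioi 0) := continuousOn_id.mul hφ.contDiffOn.continuousOn
  have hpos : ∀ s, 0 < s → 0 < h s := fun s hs => mul_pos hs (hφ.pos s hs)
  have hGmono : StrictMonoOn G (Ioi 0) := fun s hs t ht hst =>
    add_lt_add hst (hφ.strictMonoOn_mul hs ht hst)
  have hGsurj : SurjOn G (Ioi 0) (Ioi 0) := by
    intro t ht
    have ht0 : (0 : ℝ) < t := ht
    have hsurj : SurjOn h (Ioi 0) (Ioi 0) := hφ.range_eq.ge
    obtain ⟨c, hc, hct⟩ := hsurj ht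
    obtain ⟨d, hd, hdt⟩ := hsurj (half_pos ht0 : (0 : ℝ) < t / 2)
    have hc0 : (0 : ℝ) < c := hc
    -- At this point both summands of `G` are at most `t / 2`.
    have he : (0 : ℝ) < min d (t / 2) := lt_min hd (half_pos ht0)
    have h1 : G (min d (t / 2)) ≤ t := by
      have h2 : h (min d (t / 2)) ≤ h d :=
        hφ.strictMonoOn_mul.monotoneOn he hd (min_le_left _ _)
      have h3 := min_le_right d (t / 2)
      simp only [hG]
      linarith
    have h4 : t ≤ G c := by simp only [hG]; linarith
    have hpre := isPreconnected_Ioi.image G (continuousOn_id.add hcont)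
    exact hpre.ordConnected.out (mem_image_of_mem G (mem_Ioi.2 he)) (mem_image_of_mem G hc) ⟨h1, h4⟩
  set g : ℝ → ℝ := Function.invFunOn G (Ioi 0) with hg
  have hgpos : ∀ y, 0 < y → 0 < g y := fun y hy => (Function.invFunOn_pos (hGsurj hy)).1
  have hGg : ∀ y, 0 < y → G (g y) = y := fun y hy => (Function.invFunOn_pos (hGsurj hy)).2
  have hgG : ∀ s, 0 < s → g (G s) = s := fun s hs => hGmono.injOn.leftInvOn_invFunOn hs
  have hGpos : ∀ s, 0 < s → 0 < G s := fun s hs => add_pos hs (hpos s hs)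
  have hgmono : StrictMonoOn g (Ioi 0) := fun y hy z hz hyz => by
    rw [← hGmono.lt_iff_lt (hgpos y hy) (hgpos z hz), hGg y hy, hGg z hz]
    exact hyz
  have hgcont : ∀ y, 0 < y → ContinuousAt g y := fun y hy => by
    refine hgmono.continuousAt_of_image_mem_nhds (Ioi_mem_nhds hy) ?_
    refine mem_of_superset (Ioi_mem_nhds (hgpos y hy)) fun s hs => ?_
    exact ⟨G s, hGpos s hs, hgG s hs⟩
  have hh' : ∀ s, 0 < s → HasDerivAt h (deriv h s) s := fun s hs =>
    ((hasDerivAt_id s).mul (hφ.hasDerivAt hs)).differentiableAt.hasDerivAt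
  have hh'pos : ∀ s, 0 < s → 0 < deriv h s := hφ.deriv_pos
  have hg' : ∀ y, 0 < y → HasDerivAt g (1 + deriv h (g y))⁻¹ y := fun y hy => by
    have h1 : HasDerivAt G (1 + deriv h (g y)) (g y) := (hasDerivAt_id _).add (hh' _ (hgpos y hy))
    refine h1.of_local_left_inverse (hgcont y hy) (by have := hh'pos _ (hgpos y hy); positivity) ?_
    filter_upwards [Ioi_mem_nhds hy] with z hz using hGg z hz
  have hh'cont : ContinuousOn (deriv h) (Ioi 0) := by
    refine (hφ.contDiffOn.continuousOn.add (continuousOn_id.mul hφ.continuousOn_deriv)).congr ?_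
    intro s hs
    have := ((hasDerivAt_id s).mul (hφ.hasDerivAt hs)).deriv
    rw [show deriv h s = 1 * φ s + id s * deriv φ s from this]
    simp
  have hgcontOn : ContinuousOn g (Ioi 0) := fun y hy => (hgcont y hy).continuousWithinAt
  have hh'g : ContinuousOn (fun y => deriv h (g y)) (Ioi 0) := hh'cont.comp hgcontOn hgpos
  -- The inverse `g` is controlled only on `(0, ∞)`; the value at `0` has to be prescribed.
  set k : ℝ → ℝ := fun y => if y = 0 then 0 else g y with hk
  have hk0 : k 0 = 0 := if_pos rfl
  have hkg : ∀ y, 0 < y → k y = g y := fun y hy => if_neg hy.ne'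
  have hkg' : ∀ y, 0 < y → k =ᶠ[𝓝 y] g := fun y hy => by
    filter_upwards [Ioi_mem_nhds hy] with z hz using hkg z hz
  have hk' : ∀ y, 0 < y → HasDerivAt k (1 + deriv h (g y))⁻¹ y := fun y hy =>
    (hg' y hy).congr_of_eventuallyEq (hkg' y hy)
  have hle : ∀ y, 0 < y → 0 < g y ∧ 0 < h (g y) ∧ g y + h (g y) = y := fun y hy =>
    ⟨hgpos y hy, hpos _ (hgpos y hy), hGg y hy⟩
  have hinv : ∀ y, 0 < y → 0 < deriv h (g y) := fun y hy => hh'pos _ (hgpos y hy)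
  have hne : ∀ y ∈ Ioi (0 : ℝ), 1 + deriv h (g y) ≠ 0 := fun y hy => by
    have := hinv y hy
    positivity
  refine ⟨k, fun t => ?_, hk0, fun R hR => ⟨√(G R), ?_⟩, ?_, ?_⟩
  · rcases (sq_nonneg t).eq_or_lt with ht | ht
    · rw [← ht, hk0]
    · rw [hkg _ ht]
      exact (hgpos _ ht).le
  · rw [Real.sq_sqrt (hGpos R hR).le, hkg _ (hGpos R hR), hgG R hR]
  · refine contDiff_comp_sq (F' := fun y => (1 + deriv h (g y))⁻¹) (fun y hy => ?_) hk'
      (fun y hy => ?_) ?_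
    · rcases hy.eq_or_lt with rfl | hy
      · simp [hk0]
      · obtain ⟨h1, h2, h3⟩ := hle y hy
        rw [hkg y hy, abs_of_pos h1]
        linarith
    · have := hinv y hy
      rw [abs_of_pos (by positivity)]
      exact inv_le_one_of_one_le₀ (by linarith)
    · exact (continuousOn_const.add hh'g).inv₀ hne
  · refine contDiff_comp_sq (F := fun y => φ (k y) * k y)
      (F' := fun y => deriv h (g y) * (1 + deriv h (g y))⁻¹) (fun y hy => ?_) (fun y hy => ?_)
      (fun y hy => ?_) ?_
    · rcases hy.eq_or_lt with rfl | hy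
      · simp [hk0]
      · obtain ⟨h1, h2, h3⟩ := hle y hy
        rw [hkg y hy, mul_comm, abs_of_pos h2]
        linarith
    · have h1 := (hh' _ (hgpos y hy)).comp y (hg' y hy)
      refine h1.congr_of_eventuallyEq ?_
      filter_upwards [hkg' y hy] with z hz
      simp only [hz, hh, Function.comp_apply, mul_comm]
    · have := hinv y hy
      rw [abs_of_pos (by positivity), ← div_eq_mul_inv, div_le_one (by positivity)]
      linarith
    · exact hh'g.mul
        ((continuousOn_const.add hh'g).inv₀ hne)

end Profile

/-! ### Lebesgue differentiation on an open set. -/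

section Lebesgue

/-- A locally integrable function with nonnegative integrals over small balls is nonnegative. -/
theorem ae_nonneg_of_integral_closedBall_nonneg {I : Set ℝ} (hI : IsOpen I) {f : ℝ → ℝ}
    (hf : LocallyIntegrableOn f I volume)
    (h : ∀ c r, 0 < r → Metric.closedBall c (2 * r) ⊆ I → 0 ≤ ∫ x in Metric.closedBall c r, f x) :
    ∀ᵐ x ∂(volume.restrict I), 0 ≤ f x := by
  obtain ⟨U, hUo, hUI, hUf⟩ := hf.exists_nat_integrableOn
  have key : ∀ n, ∀ᵐ x, x ∈ U n ∩ I → 0 ≤ f x := by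
    intro n
    have hopen : IsOpen (U n ∩ I) := (hUo n).inter hI
    -- Extension by zero from an open piece gives a globally integrable function with unchanged
    -- averages over small balls.
    have hint : Integrable ((U n ∩ I).indicator f) :=
      (integrable_indicator_iff hopen.measurableSet).2 (hUf n)
    filter_upwards [IsUnifLocDoublingMeasure.ae_tendsto_average volume
      hint.locallyIntegrable 1] with x hx hxU
    have hlim := hx (l := 𝓝[>] (0 : ℝ)) (fun _ => x) id tendsto_id
      (by
        filter_upwards [self_mem_nhdsWithin] with δ hδ
        have hδ0 : (0 : ℝ) < δ := hδ
        exact Metric.mem_closedBall_self (by simpa using hδ0.le))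
    rw [indicator_of_mem hxU] at hlim
    refine ge_of_tendsto hlim ?_
    obtain ⟨ε, hε, hεU⟩ := Metric.isOpen_iff.1 hopen x hxU
    filter_upwards [Ioo_mem_nhdsGT (half_pos hε)] with δ hδ
    have hsub : Metric.closedBall x (2 * δ) ⊆ U n ∩ I :=
      (Metric.closedBall_subset_ball (by linarith [hδ.2])).trans hεU
    have hsub' : Metric.closedBall x δ ⊆ U n ∩ I :=
      (Metric.closedBall_subset_closedBall (by linarith [hδ.1])).trans hsub
    rw [id, setAverage_eq, smul_eq_mul]
    refine mul_nonneg (by positivity) ?_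
    rw [setIntegral_congr_fun measurableSet_closedBall
      (fun y hy => indicator_of_mem (hsub' hy) f)]
    exact h x δ hδ.1 (hsub.trans inter_subset_right)
  rw [ae_restrict_iff' hI.measurableSet]
  filter_upwards [ae_all_iff.2 key] with x hx hxI
  obtain ⟨n, hn⟩ := mem_iUnion.1 (hUI hxI)
  exact hx n ⟨hn, hxI⟩

end Lebesgue

/-! ### Test functions `Θ ω + ρ l`, with `Θ` constant near the support of `ρ`. -/

section TestFunctions

variable {m : ℕ} {φ : ℝ → ℝ} {I : Set ℝ}

/-- The derivative of `y ↦ φ(|y|) y` at `y` in the direction `ξ`. -/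
def phiDir (φ : ℝ → ℝ) (y ξ : CVec m) : CVec m :=
  φ ‖y‖ • (twistParam φ ‖y‖ • radialPart y ξ + (ξ - radialPart y ξ))

theorem phiDir_smul (c : ℝ) (y ξ : CVec m) : phiDir φ y (c • ξ) = c • phiDir φ y ξ := by
  simp only [phiDir, radialPart, re_inner_smul_right]
  module

theorem continuousOn_radialPart :
    ContinuousOn (fun z : CVec m × CVec m => radialPart z.1 z.2) {z | z.1 ≠ 0} := by
  have h : Continuous fun z : CVec m × CVec m => inner ℂ z.1 z.2 :=
    continuous_fst.inner continuous_snd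
  have h1 : Continuous fun z : CVec m × CVec m => (inner ℂ z.1 z.2).re :=
    Complex.continuous_re.comp h
  have h2 : Continuous fun z : CVec m × CVec m => ‖z.1‖ ^ 2 := continuous_fst.norm.pow 2
  refine (h1.continuousOn.div h2.continuousOn fun z hz => ?_).smul continuous_fst.continuousOn
  exact pow_ne_zero _ (norm_ne_zero_iff.2 hz)

theorem PhiAdmissible.continuousOn_phiDir (hφ : PhiAdmissible φ) :
    ContinuousOn (fun z : CVec m × CVec m => phiDir φ z.1 z.2) {z | z.1 ≠ 0} := by
  have hn : ContinuousOn (fun z : CVec m × CVec m => ‖z.1‖) {z | z.1 ≠ 0} :=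
    continuous_fst.norm.continuousOn
  have hmap : MapsTo (fun z : CVec m × CVec m => ‖z.1‖) {z | z.1 ≠ 0} (Ioi 0) :=
    fun z hz => norm_pos_iff.2 hz
  exact (hφ.contDiffOn.continuousOn.comp hn hmap).smul
    (((hφ.continuousOn_twistParam.comp hn hmap).smul continuousOn_radialPart).add
      (continuous_snd.continuousOn.sub continuousOn_radialPart))

/-- Scalar cutoff functions `Θ` for which `Θ` and `φ(Θ) Θ` are `C¹` with compact support. -/
structure IsPhiCutoff (φ : ℝ → ℝ) (I : Set ℝ) (Θ : ℝ → ℝ) : Prop where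
  contDiff : ContDiff ℝ 1 Θ
  contDiff_mul : ContDiff ℝ 1 fun x => φ (Θ x) * Θ x
  nonneg : ∀ x, 0 ≤ Θ x
  hasCompactSupport : HasCompactSupport Θ
  tsupport_subset : tsupport Θ ⊆ I

variable {Θ ρ : ℝ → ℝ} {ω l : CVec m} {R : ℝ}

theorem test_ne_zero (hω : ‖ω‖ = 1) {r : ℝ} (hr : |r| * ‖l‖ < R) : R • ω + r • l ≠ 0 := by
  intro h
  have h1 : R • ω = -(r • l) := eq_neg_of_add_eq_zero_left h
  have h2 := congrArg norm h1
  rw [norm_neg, norm_smul, norm_smul, hω, Real.norm_eq_abs, Real.norm_eq_abs] at h2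
  linarith [le_abs_self R]

/-- Near the support of `ρ` the vector stays away from `0`, where `φ(|·|)` is `C¹`; elsewhere it is
`Θ ω`, and the scalar hypothesis on `φ(Θ) Θ` applies. -/
theorem PhiAdmissible.isC1c_test (hφ : PhiAdmissible φ) (hΘ : IsPhiCutoff φ I Θ) (hω : ‖ω‖ = 1)
    (hR : 0 < R) (hρ : ContDiff ℝ 1 ρ) (hρΘ : ∀ x ∈ tsupport ρ, Θ =ᶠ[𝓝 x] fun _ => R)
    (hsmall : ∀ x, |ρ x| * ‖l‖ < R) :
    IsC1c I (fun x => Θ x • ω + ρ x • l) ∧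
      IsC1c I (fun x => φ ‖Θ x • ω + ρ x • l‖ • (Θ x • ω + ρ x • l)) := by
  have hu : ContDiff ℝ 1 fun x => Θ x • ω + ρ x • l :=
    (hΘ.contDiff.smul contDiff_const).add (hρ.smul contDiff_const)
  have hsupp : Function.support (fun x => Θ x • ω + ρ x • l) ⊆ Function.support Θ := by
    intro x hx hx0
    refine hx ?_
    by_cases h : x ∈ tsupport ρ
    · have := (hρΘ x h).self_of_nhds
      rw [hx0] at this
      exact absurd this hR.ne
    · simp only [hx0, image_eq_zero_of_notMem_tsupport h, zero_smul, add_zero]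
  have hsupp' : Function.support (fun x => φ ‖Θ x • ω + ρ x • l‖ • (Θ x • ω + ρ x • l)) ⊆
      Function.support Θ := fun x hx => hsupp fun h => hx (by
        simp only at h ⊢
        rw [h, smul_zero])
  refine ⟨⟨hu, hΘ.hasCompactSupport.mono hsupp, (closure_mono hsupp).trans hΘ.tsupport_subset⟩, ?_,
    hΘ.hasCompactSupport.mono hsupp', (closure_mono hsupp').trans hΘ.tsupport_subset⟩
  rw [contDiff_iff_contDiffAt]
  intro x
  by_cases h : x ∈ tsupport ρ
  · have hx : Θ x • ω + ρ x • l ≠ 0 := by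
      rw [(hρΘ x h).self_of_nhds]
      exact test_ne_zero hω (hsmall x)
    have h1 : ContDiffAt ℝ 1 φ ‖Θ x • ω + ρ x • l‖ :=
      hφ.contDiffOn.contDiffAt (Ioi_mem_nhds (norm_pos_iff.2 hx))
    exact (h1.comp x (hu.contDiffAt.norm ℂ hx)).smul hu.contDiffAt
  · have h1 : ContDiffAt ℝ 1 (fun x => (φ (Θ x) * Θ x) • ω) x :=
      (hΘ.contDiff_mul.smul contDiff_const).contDiffAt
    refine h1.congr_of_eventuallyEq ?_
    filter_upwards [notMem_tsupport_iff_eventuallyEq.1 h] with y hy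
    simp only [Pi.zero_apply] at hy
    rw [hy, zero_smul, add_zero, norm_smul, hω, mul_one, Real.norm_of_nonneg (hΘ.nonneg y),
      smul_smul]

/-- No mixed terms occur, because `Θ' = 0` on the support of `ρ` and `ρ' = 0` off it. The cutoff
term does not depend on `ρ`. -/
theorem PhiAdmissible.sesq_test (hφ : PhiAdmissible φ) (hΘ : IsPhiCutoff φ I Θ) (hω : ‖ω‖ = 1)
    (hρ : ContDiff ℝ 1 ρ) (hρΘ : ∀ x ∈ tsupport ρ, Θ =ᶠ[𝓝 x] fun _ => R)
    (hsmall : ∀ x, |ρ x| * ‖l‖ < R) (M : Matrix (Fin m) (Fin m) ℂ) (x : ℝ) :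
    (sesq M (deriv (fun x => Θ x • ω + ρ x • l) x)
      (deriv (fun x => φ ‖Θ x • ω + ρ x • l‖ • (Θ x • ω + ρ x • l)) x)).re =
    deriv ρ x ^ 2 * (sesq M l (phiDir φ (R • ω + ρ x • l) l)).re +
      deriv Θ x * deriv (fun x => φ (Θ x) * Θ x) x * (sesq M ω ω).re := by
  have hρx : HasDerivAt ρ (deriv ρ x) x := (hρ.differentiable one_ne_zero x).hasDerivAt
  by_cases h : x ∈ tsupport ρ
  · have hΘx := hρΘ x h
    have hΘ' : deriv Θ x = 0 := by rw [hΘx.deriv_eq, deriv_const]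
    have hu : HasDerivAt (fun x => Θ x • ω + ρ x • l) (deriv ρ x • l) x := by
      refine ((hρx.smul_const l).const_add (R • ω)).congr_of_eventuallyEq ?_
      filter_upwards [hΘx] with y hy
      rw [hy]
    have hux : Θ x • ω + ρ x • l = R • ω + ρ x • l := by rw [hΘx.self_of_nhds]
    have hne : Θ x • ω + ρ x • l ≠ 0 := hux ▸ test_ne_zero hω (hsmall x)
    have hw := hφ.hasDerivAt_smul hu hne
    have hw' : deriv (fun x => φ ‖Θ x • ω + ρ x • l‖ • (Θ x • ω + ρ x • l)) x =
        deriv ρ x • phiDir φ (R • ω + ρ x • l) l := by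
      rw [hw.deriv, ← hux, ← phiDir_smul]
      rfl
    rw [hu.deriv, hw', hΘ', sesq_smul_left, sesq_smul_right, Complex.re_ofReal_mul,
      Complex.re_ofReal_mul]
    ring
  · have hev := notMem_tsupport_iff_eventuallyEq.1 h
    have hρ' : deriv ρ x = 0 := by
      rw [hev.deriv_eq]
      simp
    have h1 : HasDerivAt (fun x => Θ x • ω + ρ x • l) (deriv Θ x • ω) x := by
      refine (((hΘ.contDiff.differentiable one_ne_zero x).hasDerivAt).smul_const
        ω).congr_of_eventuallyEq ?_
      filter_upwards [hev] with y hy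
      simp only [Pi.zero_apply] at hy
      rw [hy, zero_smul, add_zero]
    have h2 : HasDerivAt (fun x => φ ‖Θ x • ω + ρ x • l‖ • (Θ x • ω + ρ x • l))
        (deriv (fun x => φ (Θ x) * Θ x) x • ω) x := by
      refine (((hΘ.contDiff_mul.differentiable one_ne_zero x).hasDerivAt).smul_const
        ω).congr_of_eventuallyEq ?_
      filter_upwards [hev] with y hy
      simp only [Pi.zero_apply] at hy
      rw [hy, zero_smul, add_zero, norm_smul, hω, mul_one, Real.norm_of_nonneg (hΘ.nonneg y),
        smul_smul]
    rw [h1.deriv, h2.deriv, hρ', sesq_smul_left, sesq_smul_right, Complex.re_ofReal_mul,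
      Complex.re_ofReal_mul]
    ring

variable {𝒜 : ℝ → Matrix (Fin m) (Fin m) ℂ}

/-- The error term in the energy of a test function. -/
def cutoffEnergy (φ : ℝ → ℝ) (𝒜 : ℝ → Matrix (Fin m) (Fin m) ℂ) (Θ : ℝ → ℝ) (ω : CVec m)
    (x : ℝ) : ℝ :=
  deriv Θ x * deriv (fun x => φ (Θ x) * Θ x) x * (sesq (𝒜 x) ω ω).re

theorem IsPhiCutoff.integrable_energy (hΘ : IsPhiCutoff φ I Θ)
    (h𝒜 : ∀ i j, LocallyIntegrableOn (fun x => 𝒜 x i j) I volume) :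
    Integrable (cutoffEnergy φ 𝒜 Θ ω) := by
  have h1 : Continuous fun x => deriv Θ x • ω :=
    (hΘ.contDiff.continuous_deriv le_rfl).smul continuous_const
  have h2 : Continuous fun x => deriv (fun x => φ (Θ x) * Θ x) x • ω :=
    (hΘ.contDiff_mul.continuous_deriv le_rfl).smul continuous_const
  have hs : Function.support (fun x => deriv Θ x • ω) ⊆ Function.support (deriv Θ) :=
    fun x hx h => hx (by simp only [h, zero_smul])
  have h3 := integrable_sesq h𝒜 h1 h2 (hΘ.hasCompactSupport.deriv.mono hs)
    ((closure_mono hs).trans (tsupport_deriv_subset.trans hΘ.tsupport_subset))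
  refine h3.re.congr (Eventually.of_forall fun x => ?_)
  simp only [cutoffEnergy, sesq_smul_left, sesq_smul_right]
  change (_ * (_ * _) : ℂ).re = _
  rw [Complex.re_ofReal_mul, Complex.re_ofReal_mul]
  ring

/-- The energy inequality for a test function, multiplied by `c²`. -/
theorem PhiAdmissible.integral_test_nonneg (hφ : PhiAdmissible φ)
    (h𝒜 : ∀ i j, LocallyIntegrableOn (fun x => 𝒜 x i j) I volume) (hD : IsPhiDissipative φ I 𝒜)
    (hΘ : IsPhiCutoff φ I Θ) (hω : ‖ω‖ = 1)
    (hR : 0 < R) (hρ : ContDiff ℝ 1 ρ) (hρΘ : ∀ x ∈ tsupport ρ, Θ =ᶠ[𝓝 x] fun _ => R)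
    (hsmall : ∀ x, |ρ x| * ‖l‖ < R) (c : ℝ) :
    Integrable (fun x => (c * deriv ρ x) ^ 2 *
        (sesq (𝒜 x) l (phiDir φ (R • ω + ρ x • l) l)).re + c ^ 2 * cutoffEnergy φ 𝒜 Θ ω x)
        (volume.restrict I) ∧
      0 ≤ ∫ x in I, (c * deriv ρ x) ^ 2 * (sesq (𝒜 x) l (phiDir φ (R • ω + ρ x • l) l)).re +
        c ^ 2 * cutoffEnergy φ 𝒜 Θ ω x := by
  obtain ⟨hu, hw⟩ := hφ.isC1c_test hΘ hω hR hρ hρΘ hsmall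
  have h1 := hD _ hu hw
  have hint := (hu.integrable_sesq h𝒜 hw).restrict (s := I)
  have hre := integral_re hint
  have he : ∀ x, (c * deriv ρ x) ^ 2 * (sesq (𝒜 x) l (phiDir φ (R • ω + ρ x • l) l)).re +
      c ^ 2 * cutoffEnergy φ 𝒜 Θ ω x = c ^ 2 * (sesq (𝒜 x) (deriv (fun x => Θ x • ω + ρ x • l) x)
      (deriv (fun x => φ ‖Θ x • ω + ρ x • l‖ • (Θ x • ω + ρ x • l)) x)).re := fun x => by
    rw [hφ.sesq_test hΘ hω hρ hρΘ hsmall, cutoffEnergy]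
    ring
  simp only [he]
  refine ⟨hint.re.const_mul (c ^ 2), ?_⟩
  rw [integral_const_mul]
  refine mul_nonneg (sq_nonneg c) ?_
  exact h1.trans_eq hre.symm

end TestFunctions

/-! ### Rapid oscillations. -/

section Oscillation

variable {m : ℕ} {φ : ℝ → ℝ} {I : Set ℝ} {Θ ζ : ℝ → ℝ} {ω l : CVec m} {R : ℝ}
  {𝒜 : ℝ → Matrix (Fin m) (Fin m) ℂ}

/-- A function of amplitude `ε` and derivative of order `1 / ε`. -/
def wave (ζ : ℝ → ℝ) (α ε x : ℝ) : ℝ := ε * ζ x * Real.sin (x / ε ^ 2 + α)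

/-- The derivative of `wave ζ α ε`, multiplied by `ε`. -/
def waveDeriv (ζ : ℝ → ℝ) (α ε x : ℝ) : ℝ :=
  ε ^ 2 * deriv ζ x * Real.sin (x / ε ^ 2 + α) + ζ x * Real.cos (x / ε ^ 2 + α)

theorem mul_deriv_wave (hζ : ContDiff ℝ 1 ζ) (α : ℝ) {ε : ℝ} (hε : ε ≠ 0) (x : ℝ) :
    ε * deriv (wave ζ α ε) x = waveDeriv ζ α ε x := by
  have h1 : HasDerivAt ζ (deriv ζ x) x := (hζ.differentiable one_ne_zero x).hasDerivAt
  have h2 : HasDerivAt (fun x => x / ε ^ 2 + α) (1 / ε ^ 2) x :=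
    ((hasDerivAt_id x).div_const _).add_const α
  have h3 : deriv (wave ζ α ε) x = _ := ((h1.const_mul ε).mul h2.sin).deriv
  rw [h3, waveDeriv]
  field_simp

theorem contDiff_wave (hζ : ContDiff ℝ 1 ζ) (α ε : ℝ) : ContDiff ℝ 1 (wave ζ α ε) :=
  (contDiff_const.mul hζ).mul
    (Real.contDiff_sin.comp ((contDiff_id.div_const _).add contDiff_const))

theorem tsupport_wave_subset (α ε : ℝ) : tsupport (wave ζ α ε) ⊆ tsupport ζ :=
  closure_mono fun x hx h => hx (by simp [wave, h])

theorem abs_wave_le (α ε x : ℝ) : |wave ζ α ε x| ≤ |ε| * |ζ x| := by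
  rw [wave, abs_mul, abs_mul]
  exact mul_le_of_le_one_right (by positivity) (Real.abs_sin_le_one _)

theorem abs_waveDeriv_le (α : ℝ) {ε : ℝ} (hε : |ε| ≤ 1) (x : ℝ) :
    |waveDeriv ζ α ε x| ≤ |deriv ζ x| + |ζ x| := by
  have h1 : ε ^ 2 ≤ 1 := (sq_le_one_iff_abs_le_one ε).2 hε
  refine (abs_add_le _ _).trans (add_le_add ?_ ?_)
  · rw [abs_mul, abs_mul, abs_of_nonneg (sq_nonneg ε)]
    exact (mul_le_of_le_one_right (by positivity) (Real.abs_sin_le_one _)).trans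
      (mul_le_of_le_one_left (abs_nonneg _) h1)
  · rw [abs_mul]
    exact mul_le_of_le_one_right (by positivity) (Real.abs_cos_le_one _)

/-- Adding two phases a quarter period apart replaces `cos²` by `1` exactly, so pointwise
convergence suffices and no weak limit of `cos²` is needed. -/
theorem waveDeriv_sq_add (ζ : ℝ → ℝ) (ε x : ℝ) :
    waveDeriv ζ 0 ε x ^ 2 + waveDeriv ζ (Real.pi / 2) ε x ^ 2 =
      ζ x ^ 2 + ε ^ 4 * deriv ζ x ^ 2 := by
  simp only [waveDeriv, add_zero, Real.sin_add_pi_div_two, Real.cos_add_pi_div_two]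
  linear_combination (ζ x ^ 2 + ε ^ 4 * deriv ζ x ^ 2) * Real.sin_sq_add_cos_sq (x / ε ^ 2)

/-- Testing with rapid oscillations around the constant vector `R ω`. -/
theorem PhiAdmissible.integral_sq_mul_nonneg (hφ : PhiAdmissible φ)
    (h𝒜 : ∀ i j, LocallyIntegrableOn (fun x => 𝒜 x i j) I volume) (hD : IsPhiDissipative φ I 𝒜)
    (hΘ : IsPhiCutoff φ I Θ) (hω : ‖ω‖ = 1) (hR : 0 < R) (hζ : ContDiff ℝ 1 ζ)
    (hζc : HasCompactSupport ζ) (hζI : tsupport ζ ⊆ I)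
    (hζΘ : ∀ x ∈ tsupport ζ, Θ =ᶠ[𝓝 x] fun _ => R) :
    0 ≤ ∫ x in I, ζ x ^ 2 * (sesq (𝒜 x) l (phiDir φ (R • ω) l)).re := by
  have hy0 : R • ω ≠ 0 := by
    rw [← norm_ne_zero_iff, norm_smul, hω, mul_one]
    exact norm_ne_zero_iff.2 hR.ne'
  obtain ⟨Z, hZ⟩ : ∃ Z, ∀ x, |deriv ζ x| + |ζ x| ≤ Z := by
    obtain ⟨Z1, h1⟩ := hζc.exists_bound_of_continuous hζ.continuous
    obtain ⟨Z2, h2⟩ := hζc.deriv.exists_bound_of_continuous (hζ.continuous_deriv le_rfl)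
    exact ⟨Z2 + Z1, fun x => add_le_add (h2 x) (h1 x)⟩
  have hZ0 : 0 ≤ Z := (add_nonneg (abs_nonneg _) (abs_nonneg _)).trans (hZ 0)
  have hζZ : ∀ x, |ζ x| ≤ Z := fun x => by linarith [hZ x, abs_nonneg (deriv ζ x)]
  set Ψ : ℝ → CVec m := fun r => phiDir φ (R • ω + r • l) l with hΨ
  have hΨc : ContinuousAt Ψ 0 := by
    have h1 : ContinuousAt (fun z : CVec m × CVec m => phiDir φ z.1 z.2) (R • ω + (0 : ℝ) • l, l) :=
      hφ.continuousOn_phiDir.continuousAt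
        ((isOpen_ne.preimage continuous_fst).mem_nhds (by simpa using hy0))
    exact ContinuousAt.comp (f := fun r : ℝ => (R • ω + r • l, l)) h1
      (by fun_prop : Continuous fun r : ℝ => (R • ω + r • l, l)).continuousAt
  have hΨ0 : Ψ 0 = phiDir φ (R • ω) l := by simp [hΨ]
  obtain ⟨δ, hδ, hδΨ⟩ : ∃ δ > 0, ∀ r, |r| < δ → ‖Ψ r‖ ≤ ‖Ψ 0‖ + 1 := by
    obtain ⟨δ, hδ, h⟩ := Metric.continuousAt_iff.1 hΨc 1 one_pos
    refine ⟨δ, hδ, fun r hr => ?_⟩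
    have h1 := h (by simpa using hr : dist r 0 < δ)
    rw [dist_eq_norm] at h1
    linarith [norm_le_norm_add_norm_sub' (Ψ r) (Ψ 0)]
  set H : ℝ → ℝ → ℝ := fun x r => (sesq (𝒜 x) l (Ψ r)).re with hH
  have hwave0 : ∀ α x, Tendsto (fun ε => wave ζ α ε x) (𝓝[>] 0) (𝓝 0) := fun α x => by
    refine squeeze_zero_norm (fun ε => abs_wave_le α ε x) ?_
    refine Tendsto.mono_left ?_ nhdsWithin_le_nhds
    exact (by fun_prop : Continuous fun ε : ℝ => |ε| * |ζ x|).tendsto' 0 0 (by simp)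
  have hsmall : ∀ᶠ ε : ℝ in 𝓝[>] 0, 0 < ε ∧ ε ≤ 1 ∧ ∀ α x, |wave ζ α ε x| < δ ∧
      |wave ζ α ε x| * ‖l‖ < R := by
    have h1 : Tendsto (fun ε : ℝ => ε * Z) (𝓝[>] 0) (𝓝 0) :=
      ((continuous_id.mul continuous_const).tendsto' 0 0 (by simp)).mono_left nhdsWithin_le_nhds
    have h2 : Tendsto (fun ε : ℝ => ε * Z * ‖l‖) (𝓝[>] 0) (𝓝 0) := by
      simpa using h1.mul_const ‖l‖
    filter_upwards [Ioc_mem_nhdsGT one_pos, h1.eventually_lt_const hδ, h2.eventually_lt_const hR]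
      with ε hε h3 h4
    have h5 : ∀ α x, |wave ζ α ε x| ≤ ε * Z := fun α x => by
      refine (abs_wave_le α ε x).trans ?_
      rw [abs_of_pos hε.1]
      exact mul_le_mul_of_nonneg_left (hζZ x) hε.1.le
    exact ⟨hε.1, hε.2, fun α x => ⟨(h5 α x).trans_lt h3,
      (mul_le_mul_of_nonneg_right (h5 α x) (norm_nonneg l)).trans_lt h4⟩⟩
  -- This is `ε²` times the energy density: the oscillating part, whose derivative has size `1 / ε`,
  -- becomes bounded and the fixed cutoff part tends to `0`.
  set F : ℝ → ℝ → ℝ → ℝ := fun α ε x =>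
    waveDeriv ζ α ε x ^ 2 * H x (wave ζ α ε x) + ε ^ 2 * cutoffEnergy φ 𝒜 Θ ω x with hF
  have hFint : ∀ α, ∀ᶠ ε : ℝ in 𝓝[>] 0, Integrable (F α ε) (volume.restrict I) ∧
      0 ≤ ∫ x in I, F α ε x := by
    intro α
    filter_upwards [hsmall] with ε hε
    have h := hφ.integral_test_nonneg h𝒜 hD hΘ hω hR (contDiff_wave hζ α ε)
      (fun x hx => hζΘ x (tsupport_wave_subset α ε hx)) (fun x => (hε.2.2 α x).2) ε
    simp only [mul_deriv_wave hζ α hε.1.ne'] at h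
    exact h
  have hent : IntegrableOn (fun x => entrySum (𝒜 x)) (tsupport ζ) := by
    refine integrable_finsetSum _ fun i _ => integrable_finsetSum _ fun j _ => ?_
    exact ((h𝒜 i j).integrableOn_compact_subset hζI hζc).norm
  set B : ℝ := Z ^ 2 * (‖l‖ * (‖Ψ 0‖ + 1)) with hB
  have hB0 : 0 ≤ B := by positivity
  -- A majorant independent of `ε` and of the phase, integrable because the entries of `𝒜` are
  -- integrable on the compact support of `ζ`.
  set b : ℝ → ℝ := fun x => (tsupport ζ).indicator (fun x => B * entrySum (𝒜 x)) x +
    |cutoffEnergy φ 𝒜 Θ ω x| with hb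
  have hbint : Integrable b (volume.restrict I) :=
    (((integrable_indicator_iff (isClosed_tsupport ζ).measurableSet).2 (hent.const_mul B)).add
      (hΘ.integrable_energy h𝒜).abs).restrict
  have hFb : ∀ᶠ ε : ℝ in 𝓝[>] 0, ∀ α x, |F α ε x| ≤ b x := by
    filter_upwards [hsmall] with ε hε α x
    have hε1 : |ε| ≤ 1 := by rw [abs_of_pos hε.1]; exact hε.2.1
    refine (abs_add_le _ _).trans (add_le_add ?_ ?_)
    · by_cases hx : x ∈ tsupport ζ
      · rw [indicator_of_mem hx, abs_mul, abs_of_nonneg (sq_nonneg _), hB, mul_assoc]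
        have h1 : waveDeriv ζ α ε x ^ 2 ≤ Z ^ 2 :=
          sq_le_sq' (neg_le_of_abs_le ((abs_waveDeriv_le α hε1 x).trans (hZ x)))
            (le_of_abs_le ((abs_waveDeriv_le α hε1 x).trans (hZ x)))
        have h2 : |H x (wave ζ α ε x)| ≤ ‖l‖ * (‖Ψ 0‖ + 1) * entrySum (𝒜 x) := by
          refine (abs_re_sesq_le _ _ _).trans ?_
          rw [mul_comm]
          have := entrySum_nonneg (𝒜 x)
          have := hδΨ _ (hε.2.2 α x).1
          gcongr
        exact mul_le_mul h1 h2 (abs_nonneg _) (sq_nonneg _)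
      · have h1 : waveDeriv ζ α ε x = 0 := by
          rw [waveDeriv, image_eq_zero_of_notMem_tsupport hx,
            image_eq_zero_of_notMem_tsupport fun h => hx (tsupport_deriv_subset h)]
          ring
        simp [h1, indicator_of_notMem hx]
    · rw [abs_mul, abs_of_nonneg (sq_nonneg ε)]
      exact mul_le_of_le_one_left (abs_nonneg _) ((sq_le_one_iff_abs_le_one ε).2 hε1)
  have hlim : ∀ x, Tendsto (fun ε => F 0 ε x + F (Real.pi / 2) ε x) (𝓝[>] 0)
      (𝓝 (ζ x ^ 2 * H x 0)) := by
    intro x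
    have hHc : ∀ α, Tendsto (fun ε => H x (wave ζ α ε x) - H x 0) (𝓝[>] 0) (𝓝 0) := by
      intro α
      have h1 : Tendsto (fun ε => Ψ (wave ζ α ε x)) (𝓝[>] 0) (𝓝 (Ψ 0)) :=
        hΨc.tendsto.comp (hwave0 α x)
      have h2 := ((continuous_sesq (𝒜 x)).tendsto (l, Ψ 0)).comp
        (tendsto_const_nhds.prodMk_nhds h1)
      have h3 := (Complex.continuous_re.tendsto _).comp h2
      have h4 := h3.sub_const (H x 0)
      rw [sub_self] at h4
      exact h4
    have hrem : ∀ α, Tendsto (fun ε => waveDeriv ζ α ε x ^ 2 * (H x (wave ζ α ε x) - H x 0))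
        (𝓝[>] 0) (𝓝 0) := by
      intro α
      have h1 : Tendsto (fun ε => Z ^ 2 * |H x (wave ζ α ε x) - H x 0|) (𝓝[>] 0) (𝓝 0) := by
        simpa using (hHc α).abs.const_mul (Z ^ 2)
      refine squeeze_zero_norm' ?_ h1
      filter_upwards [hsmall] with ε hε
      have hε1 : |ε| ≤ 1 := by rw [abs_of_pos hε.1]; exact hε.2.1
      rw [Real.norm_eq_abs, abs_mul, abs_of_nonneg (sq_nonneg _)]
      refine mul_le_mul_of_nonneg_right ?_ (abs_nonneg _)
      exact sq_le_sq' (neg_le_of_abs_le ((abs_waveDeriv_le α hε1 x).trans (hZ x)))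
        (le_of_abs_le ((abs_waveDeriv_le α hε1 x).trans (hZ x)))
    have hmain : Tendsto (fun ε : ℝ => (ζ x ^ 2 + ε ^ 4 * deriv ζ x ^ 2) * H x 0 +
        2 * ε ^ 2 * cutoffEnergy φ 𝒜 Θ ω x) (𝓝[>] 0) (𝓝 (ζ x ^ 2 * H x 0)) :=
      ((by fun_prop : Continuous fun ε : ℝ => (ζ x ^ 2 + ε ^ 4 * deriv ζ x ^ 2) * H x 0 +
        2 * ε ^ 2 * cutoffEnergy φ 𝒜 Θ ω x).tendsto' 0 _ (by simp)).mono_left nhdsWithin_le_nhds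
    have h := (hmain.add (hrem 0)).add (hrem (Real.pi / 2))
    rw [add_zero, add_zero] at h
    refine h.congr fun ε => ?_
    rw [← waveDeriv_sq_add]
    simp only [hF]
    ring
  have hconv := tendsto_integral_filter_of_dominated_convergence (μ := volume.restrict I)
    (F := fun ε x => F 0 ε x + F (Real.pi / 2) ε x) (fun x => 2 * b x)
    (l := 𝓝[>] (0 : ℝ)) ?_ ?_ (hbint.const_mul 2) (Eventually.of_forall hlim)
  · simp only [hH, hΨ0] at hconv
    refine ge_of_tendsto hconv ?_
    filter_upwards [hFint 0, hFint (Real.pi / 2)] with ε h1 h2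
    rw [integral_add h1.1 h2.1]
    exact add_nonneg h1.2 h2.2
  · filter_upwards [hFint 0, hFint (Real.pi / 2)] with ε h1 h2
    exact (h1.1.add h2.1).aestronglyMeasurable
  · filter_upwards [hFb] with ε h
    refine Eventually.of_forall fun x => ?_
    rw [Real.norm_eq_abs, two_mul]
    exact (abs_add_le _ _).trans (add_le_add (h 0 x) (h _ x))

end Oscillation

/-! ### From dissipativity to the pointwise condition, and the essential infimum. -/

section Necessity

variable {m : ℕ} {φ : ℝ → ℝ} {I : Set ℝ} {𝒜 : ℝ → Matrix (Fin m) (Fin m) ℂ}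

theorem PhiAdmissible.exists_isPhiCutoff (hφ : PhiAdmissible φ) {c r R : ℝ} (hr : 0 < r)
    (hI : Metric.closedBall c (2 * r) ⊆ I) (hR : 0 < R) :
    ∃ Θ, IsPhiCutoff φ I Θ ∧ ∀ x ∈ Metric.ball c (7 / 4 * r), Θ =ᶠ[𝓝 x] fun _ => R := by
  obtain ⟨k, hk0, hkz, hkR, hk1, hk2⟩ := hφ.exists_profile
  obtain ⟨T, hT⟩ := hkR R hR
  -- The plateau radius `7/4 r` leaves room for oscillation profiles supported in the ball of radius
  -- `3/2 r`.
  let τ : ContDiffBump c := ⟨7 / 4 * r, 2 * r, by linarith, by linarith⟩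
  have hτ : ContDiff ℝ 1 fun x => T * τ x := contDiff_const.mul τ.contDiff
  have hsupp : Function.support (fun x => k ((T * τ x) ^ 2)) ⊆ Function.support τ := fun x hx h =>
    hx (by simp only [h, mul_zero, ne_eq, OfNat.ofNat_ne_zero, not_false_eq_true, zero_pow, hkz])
  refine ⟨fun x => k ((T * τ x) ^ 2), ⟨hk1.comp hτ, hk2.comp hτ, fun x => hk0 _,
    τ.hasCompactSupport.mono hsupp, (closure_mono hsupp).trans ?_⟩, fun x hx => ?_⟩
  · exact (τ.tsupport_eq.le.trans hI)
  · filter_upwards [τ.eventuallyEq_one_of_mem_ball hx] with y hy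
    rw [hy, Pi.one_apply, mul_one, hT]

theorem locallyIntegrableOn_re_sesq (hI : IsOpen I)
    (h𝒜 : ∀ i j, LocallyIntegrableOn (fun x => 𝒜 x i j) I volume) (ξ η : CVec m) :
    LocallyIntegrableOn (fun x => (sesq (𝒜 x) ξ η).re) I volume := by
  rw [locallyIntegrableOn_iff hI.isLocallyClosed]
  intro K hKI hK
  have : IntegrableOn (fun x => sesq (𝒜 x) ξ η) K := by
    simp only [sesq_eq_sum]
    exact integrable_finsetSum _ fun i _ => integrable_finsetSum _ fun j _ =>
      (((h𝒜 i j).integrableOn_compact_subset hKI hK).mul_const _).mul_const _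
  exact this.re

theorem PhiAdmissible.integral_closedBall_nonneg (hφ : PhiAdmissible φ) (hI : IsOpen I)
    (h𝒜 : ∀ i j, LocallyIntegrableOn (fun x => 𝒜 x i j) I volume) (hD : IsPhiDissipative φ I 𝒜)
    {y : CVec m} (hy : y ≠ 0) (l : CVec m) {c r : ℝ} (hr : 0 < r)
    (hcr : Metric.closedBall c (2 * r) ⊆ I) :
    0 ≤ ∫ x in Metric.closedBall c r, (sesq (𝒜 x) l (phiDir φ y l)).re := by
  set f : ℝ → ℝ := fun x => (sesq (𝒜 x) l (phiDir φ y l)).re with hf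
  have hn : 0 < ‖y‖ := norm_pos_iff.2 hy
  obtain ⟨Θ, hΘ, hΘR⟩ := hφ.exists_isPhiCutoff hr hcr hn
  have hpos : ∀ n : ℕ, 0 < 1 / ((n : ℝ) + 2) := fun n => by positivity
  have hle : ∀ n : ℕ, 1 / ((n : ℝ) + 2) ≤ 1 / 2 := fun n =>
    one_div_le_one_div_of_le two_pos (by linarith [n.cast_nonneg (α := ℝ)])
  -- These bumps converge pointwise to the indicator of the closed ball of radius `r`; the shift `n
  -- + 2` keeps all outer radii at most `3/2 r`.
  let ζ : ℕ → ContDiffBump c := fun n => ⟨r, (1 + 1 / ((n : ℝ) + 2)) * r, hr, by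
    nlinarith [hpos n]⟩
  have hζs : ∀ n, tsupport (ζ n) ⊆ Metric.closedBall c (3 / 2 * r) := fun n => by
    rw [(ζ n).tsupport_eq]
    refine Metric.closedBall_subset_closedBall ?_
    change (1 + 1 / ((n : ℝ) + 2)) * r ≤ 3 / 2 * r
    exact mul_le_mul_of_nonneg_right (by linarith [hle n]) hr.le
  have hsub : Metric.closedBall c (3 / 2 * r) ⊆ Metric.ball c (7 / 4 * r) :=
    Metric.closedBall_subset_ball (by linarith)
  have hsub' : Metric.closedBall c (3 / 2 * r) ⊆ I :=
    (Metric.closedBall_subset_closedBall (by linarith)).trans hcr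
  have hsub1 : Metric.closedBall c r ⊆ I :=
    (Metric.closedBall_subset_closedBall (by linarith)).trans hcr
  have hω : ‖(‖y‖⁻¹ : ℝ) • y‖ = 1 := by
    rw [norm_smul, norm_inv, norm_norm, inv_mul_cancel₀ hn.ne']
  have hyω : ‖y‖ • (‖y‖⁻¹ : ℝ) • y = y := by
    rw [smul_smul, mul_inv_cancel₀ hn.ne', one_smul]
  have hineq : ∀ n, 0 ≤ ∫ x in I, ζ n x ^ 2 * f x := fun n => by
    have h := hφ.integral_sq_mul_nonneg (l := l) h𝒜 hD hΘ hω hn (ζ n).contDiff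
      (ζ n).hasCompactSupport ((hζs n).trans hsub') fun x hx => hΘR x (hsub (hζs n hx))
    rwa [hyω] at h
  have hloc := locallyIntegrableOn_re_sesq hI h𝒜 l (phiDir φ y l)
  have hfI : IntegrableOn f (Metric.closedBall c (3 / 2 * r)) :=
    hloc.integrableOn_compact_subset hsub' (isCompact_closedBall _ _)
  have hconv : Tendsto (fun n => ∫ x in I, ζ n x ^ 2 * f x) atTop
      (𝓝 (∫ x in I, (Metric.closedBall c r).indicator f x)) := by
    refine tendsto_integral_of_dominated_convergence
      ((Metric.closedBall c (3 / 2 * r)).indicator fun x => |f x|) (fun n => ?_) ?_ (fun n => ?_) ?_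
    · exact ((ζ n).continuous.pow 2).aestronglyMeasurable.mul
        (hloc.aestronglyMeasurable)
    · exact ((integrable_indicator_iff measurableSet_closedBall).2 hfI.abs).restrict
    · refine Eventually.of_forall fun x => ?_
      by_cases hx : x ∈ Metric.closedBall c (3 / 2 * r)
      · rw [indicator_of_mem hx, Real.norm_eq_abs, abs_mul, abs_of_nonneg (sq_nonneg _)]
        refine mul_le_of_le_one_left (abs_nonneg _) ?_
        exact pow_le_one₀ (ζ n).nonneg (ζ n).le_one
      · simp [indicator_of_notMem hx, image_eq_zero_of_notMem_tsupport fun h => hx (hζs n h)]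
    · refine Eventually.of_forall fun x => ?_
      by_cases hx : x ∈ Metric.closedBall c r
      · rw [indicator_of_mem hx]
        refine tendsto_const_nhds.congr fun n => ?_
        rw [(ζ n).one_of_mem_closedBall hx, one_pow, one_mul]
      · rw [indicator_of_notMem hx]
        rw [Metric.mem_closedBall, not_le] at hx
        refine tendsto_const_nhds.congr' ?_
        have h1 : Tendsto (fun n : ℕ => (1 + 1 / ((n : ℝ) + 2)) * r) atTop (𝓝 r) := by
          have h2 : Tendsto (fun n : ℕ => 1 / ((n : ℝ) + 2)) atTop (𝓝 0) :=
            tendsto_const_nhds.div_atTop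
              (tendsto_atTop_add_const_right _ _ tendsto_natCast_atTop_atTop)
          simpa using (h2.const_add 1).mul_const r
        filter_upwards [h1.eventually_le_const hx] with n hn
        rw [(ζ n).zero_of_le_dist hn]
        ring
  have h := ge_of_tendsto hconv (Eventually.of_forall hineq)
  rwa [setIntegral_indicator measurableSet_closedBall, inter_eq_right.2 hsub1] at h

/-- The pointwise consequence of dissipativity. -/
theorem PhiAdmissible.ae_re_sesq_phiDir_nonneg (hφ : PhiAdmissible φ) (hI : IsOpen I)
    (h𝒜 : ∀ i j, LocallyIntegrableOn (fun x => 𝒜 x i j) I volume) (hD : IsPhiDissipative φ I 𝒜) :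
    ∀ᵐ x ∂(volume.restrict I), ∀ y l : CVec m, y ≠ 0 →
      0 ≤ (sesq (𝒜 x) l (phiDir φ y l)).re := by
  have h1 : ∀ n : ℕ, ∀ᵐ x ∂(volume.restrict I),
      (TopologicalSpace.denseSeq (CVec m × CVec m) n).1 ≠ 0 →
        0 ≤ (sesq (𝒜 x) (TopologicalSpace.denseSeq (CVec m × CVec m) n).2
          (phiDir φ (TopologicalSpace.denseSeq (CVec m × CVec m) n).1
            (TopologicalSpace.denseSeq (CVec m × CVec m) n).2)).re := by
    intro n
    by_cases hn : (TopologicalSpace.denseSeq (CVec m × CVec m) n).1 = 0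
    · exact Eventually.of_forall fun x h => absurd hn h
    · filter_upwards [ae_nonneg_of_integral_closedBall_nonneg hI
        (locallyIntegrableOn_re_sesq hI h𝒜 _ _)
        fun c r hr hcr => hφ.integral_closedBall_nonneg hI h𝒜 hD hn _ hr hcr] with x hx _
      exact hx
  filter_upwards [ae_all_iff.2 h1] with x hx y l hy
  -- The exceptional null set is chosen for a countable dense family of pairs; negativity is an open
  -- condition in `(y, l)` and would be met by one of them.
  by_contra! hneg
  have hU : IsOpen {z : CVec m × CVec m | z.1 ≠ 0} := isOpen_ne.preimage continuous_fst
  have hc : ContinuousOn (fun z : CVec m × CVec m => (sesq (𝒜 x) z.2 (phiDir φ z.1 z.2)).re)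
      {z | z.1 ≠ 0} := by
    have h2 : ContinuousOn (fun z : CVec m × CVec m => (z.2, phiDir φ z.1 z.2)) {z | z.1 ≠ 0} :=
      continuous_snd.continuousOn.prodMk hφ.continuousOn_phiDir
    have h3 := (continuous_sesq (𝒜 x)).comp_continuousOn h2
    exact Complex.continuous_re.comp_continuousOn h3
  obtain ⟨n, hn⟩ := (TopologicalSpace.denseRange_denseSeq (CVec m × CVec m)).exists_mem_open
    (hc.isOpen_inter_preimage hU isOpen_Iio) ⟨(y, l), hy, hneg⟩
  exact absurd (hx n hn.1) (not_le.2 hn.2)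

/-- Necessity of the algebraic condition. -/
theorem PhiAdmissible.ae_twistNonneg (hφ : PhiAdmissible φ) (hΛ : capLambdaInf φ ^ 2 < 1)
    (hI : IsOpen I) (h𝒜 : ∀ i j, LocallyIntegrableOn (fun x => 𝒜 x i j) I volume)
    (hD : IsPhiDissipative φ I 𝒜) :
    ∀ᵐ x ∂(volume.restrict I), TwistNonneg (twistParamInf φ) (𝒜 x) := by
  filter_upwards [hφ.ae_re_sesq_phiDir_nonneg hI h𝒜 hD] with x hx ξ η hξη
  rcases exists_unit_parallel hξη with ⟨rfl, rfl⟩ | ⟨ω, c, hω, rfl, h0⟩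
  · simp [sesq_zero_left]
  -- Taking `y = s ω` makes `c ω` the radial part of `c ω + η`, with parameter `p(s)`; the size `s`
  -- is free and is sent to infinity.
  have hs : ∀ s : ℝ, 0 < s →
      0 ≤ (sesq (𝒜 x) (c • ω + η) (twistParam φ s • c • ω + η)).re := by
    intro s hs
    have hns : ‖s • ω‖ = s := by rw [norm_smul, hω, mul_one, Real.norm_of_nonneg hs.le]
    have hne : s • ω ≠ 0 := by rw [← norm_ne_zero_iff, hns]; exact hs.ne'
    have h1 := hx (s • ω) (c • ω + η) hne
    have h2 : radialPart (s • ω) (c • ω + η) = c • ω := by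
      rw [radialPart, hns, inner_add_right, Complex.add_re, re_inner_smul_left, re_inner_smul_left,
        re_inner_smul_right, re_inner_self, hω, h0, smul_smul]
      congr 1
      field_simp
      ring
    rw [phiDir, h2, hns, sesq_smul_right, Complex.re_ofReal_mul, add_sub_cancel_left] at h1
    exact nonneg_of_mul_nonneg_right h1 (hφ.pos s hs)
  have hlim : Tendsto (fun s => (sesq (𝒜 x) (c • ω + η) (twistParam φ s • c • ω + η)).re) atTop
      (𝓝 (sesq (𝒜 x) (c • ω + η) (twistParamInf φ • c • ω + η)).re) := by
    simp only [re_sesq_twist]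
    have := hφ.tendsto_twistParam hΛ
    exact ((this.mul_const _).add ((this.mul_const _).add_const _)).add_const _
  refine ge_of_tendsto hlim ?_
  filter_upwards [eventually_gt_atTop 0] with s h using hs s h

theorem PhiAdmissible.isPhiDissipative_iff (hφ : PhiAdmissible φ) (hΛ : capLambdaInf φ ^ 2 < 1)
    (hI : IsOpen I) (h𝒜 : ∀ i j, LocallyIntegrableOn (fun x => 𝒜 x i j) I volume) :
    IsPhiDissipative φ I 𝒜 ↔ ∀ᵐ x ∂(volume.restrict I),
      ∀ ξ ω : CVec m, ‖ω‖ = 1 → 0 ≤ formP (capLambdaInf φ) (𝒜 x) ξ ω := by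
  simp only [← twistNonneg_iff_formP _ hΛ]
  exact ⟨hφ.ae_twistNonneg hΛ hI h𝒜, hφ.isPhiDissipative hΛ h𝒜⟩

/-- Subtracting `κ` lowers `formP` by `κ (|ξ|² - L² (Re ⟨ξ, ω⟩)²)`, which lies between `κ (1 - L²)
|ξ|²` and `κ |ξ|²`; the condition `L² < 1` keeps the lower bound positive. -/
theorem PhiAdmissible.exists_isPhiDissipative_sub_iff (hφ : PhiAdmissible φ)
    (hΛ : capLambdaInf φ ^ 2 < 1) (hI : IsOpen I)
    (h𝒜 : ∀ i j, LocallyIntegrableOn (fun x => 𝒜 x i j) I volume) :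
    (∃ κ : ℝ, 0 < κ ∧ IsPhiDissipative φ I (fun x => 𝒜 x - (κ : ℂ) • 1)) ↔
      ∃ κ : ℝ, 0 < κ ∧ ∀ᵐ x ∂(volume.restrict I),
        ∀ ξ ω : CVec m, ‖ω‖ = 1 → κ * ‖ξ‖ ^ 2 ≤ formP (capLambdaInf φ) (𝒜 x) ξ ω := by
  have hint : ∀ κ : ℝ, ∀ i j,
      LocallyIntegrableOn (fun x => (𝒜 x - (κ : ℂ) • 1) i j) I volume := fun κ i j =>
    (h𝒜 i j).sub ((locallyIntegrable_const _).locallyIntegrableOn I)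
  have hκ : ∀ κ : ℝ, IsPhiDissipative φ I (fun x => 𝒜 x - (κ : ℂ) • 1) ↔
      ∀ᵐ x ∂(volume.restrict I), ∀ ξ ω : CVec m, ‖ω‖ = 1 →
        0 ≤ formP (capLambdaInf φ) (𝒜 x - (κ : ℂ) • 1) ξ ω :=
    fun κ => hφ.isPhiDissipative_iff hΛ hI (hint κ)
  simp only [hκ]
  set L := capLambdaInf φ
  constructor
  · rintro ⟨κ, hκ, h⟩
    refine ⟨κ * (1 - L ^ 2), mul_pos hκ (by linarith), ?_⟩
    filter_upwards [h] with x hx ξ ω hω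
    have h1 := hx ξ ω hω
    rw [formP_sub_smul_one _ _ _ _ hω] at h1
    have h2 : (inner ℂ ω ξ).re ^ 2 ≤ ‖ξ‖ ^ 2 := by
      have h3 := (Complex.abs_re_le_norm _).trans (norm_inner_le_norm (𝕜 := ℂ) ω ξ)
      rw [hω, one_mul] at h3
      exact sq_le_sq' (neg_le_of_abs_le h3) (le_of_abs_le h3)
    have h4 := mul_le_mul_of_nonneg_left h2 (mul_nonneg hκ.le (sq_nonneg L))
    linarith
  · rintro ⟨κ, hκ, h⟩
    refine ⟨κ, hκ, ?_⟩
    filter_upwards [h] with x hx ξ ω hω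
    rw [formP_sub_smul_one _ _ _ _ hω]
    have h1 := hx ξ ω hω
    have h2 : 0 ≤ κ * (L ^ 2 * (inner ℂ ω ξ).re ^ 2) := by positivity
    linarith

/-- For almost every `x` the bound holds almost everywhere on the product of spheres. The surface
measure charges every nonempty open set and the form is continuous, so it holds everywhere there;
homogeneity in `ξ` removes the normalisation. -/
theorem essInfP_pos_iff (L : ℝ) (I : Set ℝ) (𝒜 : ℝ → Matrix (Fin m) (Fin m) ℂ) :
    0 < essInfP L I 𝒜 ↔ ∃ κ : ℝ, 0 < κ ∧ ∀ᵐ x ∂(volume.restrict I),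
      ∀ ξ ω : CVec m, ‖ω‖ = 1 → κ * ‖ξ‖ ^ 2 ≤ formP L (𝒜 x) ξ ω := by
  constructor
  · intro h
    -- A real `κ` strictly below the essential infimum also covers the value `⊤`.
    obtain ⟨κ, hκ0, hκ⟩ := EReal.lt_iff_exists_real_btwn.1 h
    refine ⟨κ, by exact_mod_cast hκ0, ?_⟩
    filter_upwards [Measure.ae_ae_of_ae_prod (ae_lt_of_lt_essInf hκ)] with x hx ξ ω hω
    have hc : Continuous fun z : Metric.sphere (0 : CVec m) 1 × Metric.sphere (0 : CVec m) 1 =>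
        formP L (𝒜 x) z.1 z.2 := by
      have h1 : Continuous fun z : Metric.sphere (0 : CVec m) 1 × Metric.sphere (0 : CVec m) 1 =>
          ((z.1 : CVec m), (z.2 : CVec m)) :=
        (continuous_subtype_val.comp continuous_fst).prodMk
          (continuous_subtype_val.comp continuous_snd)
      have h2 := (continuous_formP (𝒜 x) L).comp h1
      exact h2
    have hall : ∀ z : Metric.sphere (0 : CVec m) 1 × Metric.sphere (0 : CVec m) 1,
        κ ≤ formP L (𝒜 x) z.1 z.2 := by
      have : ((volume : Measure (CVec m)).toSphere.prod
        (volume : Measure (CVec m)).toSphere).IsOpenPosMeasure := Measure.prod.instIsOpenPosMeasure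
      have hd := Measure.dense_of_ae hx
      intro z
      refine closure_minimal (fun w hw => ?_) (isClosed_le continuous_const hc) (hd z)
      have hw' : (κ : EReal) < (formP L (𝒜 x) w.1 w.2 : ℝ) := hw
      exact (EReal.coe_lt_coe_iff.1 hw').le
    rcases eq_or_ne ξ 0 with rfl | hξ
    · have := formP_smul (𝒜 x) L 0 (0 : CVec m) ω
      simp only [smul_zero] at this
      rw [this]
      simp
    · have hn := norm_ne_zero_iff.2 hξ
      have h1 := hall ⟨⟨(‖ξ‖⁻¹ : ℝ) • ξ, by
        rw [mem_sphere_zero_iff_norm, norm_smul, norm_inv, norm_norm, inv_mul_cancel₀ hn]⟩,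
        ⟨ω, by rw [mem_sphere_zero_iff_norm, hω]⟩⟩
      simp only [formP_smul] at h1
      rw [inv_pow, inv_mul_eq_div, le_div_iff₀ (by positivity)] at h1
      exact h1
  · rintro ⟨κ, hκ, h⟩
    have hκ' : (0 : EReal) < (κ : EReal) := by exact_mod_cast hκ
    refine hκ'.trans_le (le_essInf_of_ae_le _ ?_)
    filter_upwards [Measure.quasiMeasurePreserving_fst.ae h] with z hz
    have h1 := hz z.2.1 z.2.2 (mem_sphere_zero_iff_norm.1 z.2.2.2)
    rw [mem_sphere_zero_iff_norm.1 z.2.1.2, one_pow, mul_one] at h1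
    exact EReal.coe_le_coe_iff.2 h1

end Necessity

end

theorem mainTheorem5 (φ : ℝ → ℝ) (hφ : PhiAdmissible φ)
    (hΛ : capLambdaInf φ ^ 2 < 1)
    (m : ℕ) (a b : EReal) (hab : a < b)
    (𝒜 : ℝ → Matrix (Fin m) (Fin m) ℂ)
    (h𝒜 : ∀ i j, LocallyIntegrableOn (fun x => 𝒜 x i j) (openInterval a b) volume) :
    (IsStrictPhiDissipative φ (openInterval a b) 𝒜 ↔
      ∃ κ : ℝ, 0 < κ ∧ ∀ᵐ x ∂(volume.restrict (openInterval a b)),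
        ∀ ξ ω : CVec m, ‖ω‖ = 1 → κ * ‖ξ‖ ^ 2 ≤ formP (capLambdaInf φ) (𝒜 x) ξ ω) ∧
    ((∃ κ : ℝ, 0 < κ ∧
        IsPhiDissipative φ (openInterval a b) (fun x => 𝒜 x - (κ : ℂ) • 1)) ↔
      0 < essInfP (capLambdaInf φ) (openInterval a b) 𝒜) := by
  have h := hφ.exists_isPhiDissipative_sub_iff hΛ (isOpen_openInterval a b) h𝒜
  exact ⟨(hφ.isStrictPhiDissipative_iff hΛ h𝒜).trans h, h.trans (essInfP_pos_iff _ _ _).symm⟩
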